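/- For a space $X$, let $F_2(X)=\{(x,y)\in X^2: x\neq y\}$ be the ordered configuration space of two points in $X$ and $B_2(X)=F_2(X)/\Sigma_2$ the unordered one; homology is singular homology with integer coefficients. Let $\mathsf S_3$ be the star graph, that is, the cone on $\{1,2,3\}$. The canonical loop $S^1\to B_2(\mathsf S_3)$ is the quotient by the antipodal action on $S^1$ and the exchange of the two points of the following $\Sigma_2$-equivariant loop $S^1\to F_2(\mathsf S_3)$: the two points are half a period apart on the same itinerary, which rests at the end of leg 1, moves through the central vertex to the end of leg 2, rests there, moves through the central vertex to the end of leg 3, rests there, and moves through the central vertex back to the end of leg 1, in such a way that at each time at least one of the two points is resting at the end of a leg. A topological embedding $\varphi:\mathsf S_3\to X$ determines a star class in $H_1(B_2(X))$, namely the image of the fundamental class of $S^1$ under the composite $S^1\to B_2(\mathsf S_3)\xrightarrow{B_2(\varphi)}B_2(X)$. Let $\Theta_3$ be the theta graph, that is, the suspension of a three-point set, drawn in the plane as a closed disc's boundary circle together with a vertical diameter (up to an orientation-preserving homeomorphism of the plane, piecewise linearly: the two vertices $(0,1)$ and $(0,-1)$ are joined by three edges, which are straight above and below the horizontal axis and cross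 it at $(-1,0)$, $(0,0)$ and $(1,0)$). A star class at a vertex $v$ of $\Theta_3$ oriented counterclockwise is the star class of a topological embedding $\varphi:\mathsf S_3\to\Theta_3$ that sends the central vertex to $v$ and whose legs $1,2,3$ leave $v$ in counterclockwise cyclic order in the plane. **Proposition.** In $H_1(B_2(\Theta_3))$, there is exactly one star class oriented counterclockwise at the top vertex and exactly one at the bottom vertex, and these two classes coincide. -/

import Mathlib

open CategoryTheory Topology Filter

noncomputable section

/-! ### Configuration spaces -/

/-- The ordered configuration space `F_k(X)`: `k`-tuples of pairwise distinct points of `X`, with the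
subspace topology from `X ^ k`. -/
abbrev OrdConf (k : ℕ) (X : Type) : Type := {x : Fin k → X // Function.Injective x}

/-- Two ordered configurations are identified when they differ by a permutation of the labels. -/
def confSetoid (k : ℕ) (X : Type) : Setoid (OrdConf k X) where
  r x y := ∃ σ : Equiv.Perm (Fin k), ∀ i, y.1 i = x.1 (σ i)
  iseqv :=
    { refl := fun _ => ⟨1, fun _ => rfl⟩
      symm := by
        rintro x y ⟨σ, h⟩
        exact ⟨σ⁻¹, fun i => by rw [h]; simp⟩
      trans := by
        rintro x y z ⟨σ, h⟩ ⟨τ, h'⟩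
        exact ⟨σ * τ, fun i => by rw [h', h]; rfl⟩ }

/-- The unordered configuration space `B_k(X)`, the orbit space of `F_k(X)` under the symmetric
group, with the quotient topology. -/
abbrev UnordConf (k : ℕ) (X : Type) : Type := Quotient (confSetoid k X)

/-- The map `B_k(φ) : B_k(X) → B_k(Y)` induced by an injective continuous map `φ : X → Y`. -/
def unordConfMap (k : ℕ) {X Y : Type} [TopologicalSpace X] [TopologicalSpace Y] (φ : C(X, Y))
    (hφ : Function.Injective φ) : C(UnordConf k X, UnordConf k Y) where
  toFun := Quotient.map (fun x : OrdConf k X => (⟨fun i => φ (x.1 i), hφ.comp x.2⟩ : OrdConf k Y))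
    (by
      rintro x y ⟨σ, h⟩
      exact ⟨σ, fun i => congrArg φ (h i)⟩)
  continuous_toFun := by
    refine Continuous.quotient_map' ?_ _
    exact Continuous.subtype_mk (continuous_pi fun i =>
      φ.continuous.comp ((continuous_apply i).comp continuous_subtype_val)) _

/-! ### First homology and the fundamental class of the circle -/

/-- Singular homology in degree one with integer coefficients. -/
abbrev H1 (X : Type) [TopologicalSpace X] : ModuleCat.{0} ℤ :=
  ((AlgebraicTopology.singularHomologyFunctor (ModuleCat.{0} ℤ) 1).obj (ModuleCat.of ℤ ℤ)).obj
    (TopCat.of X)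

/-- The homomorphism induced on first homology by a continuous map. -/
abbrev H1map {X Y : Type} [TopologicalSpace X] [TopologicalSpace Y] (f : C(X, Y)) : H1 X ⟶ H1 Y :=
  ((AlgebraicTopology.singularHomologyFunctor (ModuleCat.{0} ℤ) 1).obj (ModuleCat.of ℤ ℤ)).map
    (TopCat.ofHom f)

/-- The circle `S¹ = ℝ / ℤ`, oriented by the standard orientation of `ℝ`. -/
abbrev S1 : Type := AddCircle (1 : ℝ)

section

open scoped Simplicial

/-- The singular `1`-simplex `[0, 1] → ℝ / ℤ`, `t ↦ t mod 1`, where the point of the standard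
`1`-simplex with barycentric coordinates `(1 - t, t)` is identified with `t`. -/
def circleSimplex : (TopCat.toSSet.obj (TopCat.of S1)) _⦋1⦌ :=
  (TopCat.toSSetObjEquiv (TopCat.of S1) (.op ⦋1⦌)).symm
    (⟨fun x : stdSimplex ℝ (Fin 2) => ((x.1 1 : ℝ) : S1), by
      exact (AddCircle.continuous_mk' 1).comp ((continuous_apply 1).comp continuous_subtype_val)⟩ :
      C(stdSimplex ℝ (Fin 2), S1))


lemma circleSimplex_face (i j : Fin 2) :
    (TopCat.toSSet.obj (TopCat.of S1)).δ i circleSimplex =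
      (TopCat.toSSet.obj (TopCat.of S1)).δ j circleSimplex := by
  apply (TopCat.toSSetObjEquiv (TopCat.of S1) (.op ⦋0⦌)).injective
  ext x
  suffices h : ∀ i : Fin 2, (TopCat.toSSetObjEquiv (TopCat.of S1) (.op ⦋0⦌))
      ((TopCat.toSSet.obj (TopCat.of S1)).δ i circleSimplex) x = (0 : S1) by
    rw [h i, h j]
  intro i
  change (((stdSimplex.map (SimplexCategory.δ i) x).1 1 : ℝ) : S1) = 0
  have hx : x = stdSimplex.vertex (S := ℝ) (X := Fin 1) 0 := Subsingleton.elim _ _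
  rw [hx, stdSimplex.map_vertex]
  fin_cases i
  · change (((Pi.single 1 1 : Fin 2 → ℝ) 1 : ℝ) : S1) = 0
    simp
  · change (((Pi.single 0 1 : Fin 2 → ℝ) 1 : ℝ) : S1) = 0
    simp

/-- The homomorphism `ℤ → H₁(S¹)` sending `1` to the class of the `1`-cycle `circleSimplex`. -/
def fundamentalClassHom : ModuleCat.of ℤ ℤ ⟶ H1 S1 :=
  ((TopCat.toSSet.obj (TopCat.of S1)).chainComplex (ModuleCat.of ℤ ℤ)).liftCycles
      ((TopCat.toSSet.obj (TopCat.of S1)).ιChainComplex circleSimplex) 0 (by simp) (by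
        rw [SSet.ιChainComplex_d, Fin.sum_univ_two, circleSimplex_face 1 0]
        simp) ≫
    ((TopCat.toSSet.obj (TopCat.of S1)).chainComplex (ModuleCat.of ℤ ℤ)).homologyπ 1

end

/-- The fundamental class of the circle. -/
def fundamentalClass : H1 S1 := fundamentalClassHom.hom (1 : ℤ)

/-! ### The star graph and its orbiting pair of particles -/

/-- The star graph `S_n`, the cone on `{0, …, n - 1}`, realised as the union of the segments from
the origin to the standard basis vectors of `ℝⁿ`. -/
def starSet (n : ℕ) : Set (Fin n → ℝ) :=
  {x | (∀ i, 0 ≤ x i ∧ x i ≤ 1) ∧ ∀ i j, i ≠ j → x i = 0 ∨ x j = 0}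

/-- The star graph `S_n` as a topological space. -/
abbrev StarGraph (n : ℕ) : Type := starSet n

/-- The central vertex of the star graph. -/
def starCenter (n : ℕ) : StarGraph n := ⟨0, by simp [starSet]⟩

/-- The point of the `i`th leg of the star graph at distance `t` from the central vertex. -/
def starLeg {n : ℕ} (i : Fin n) (t : unitInterval) : StarGraph n :=
  ⟨Pi.single i (t : ℝ), by
    refine ⟨fun j => ?_, fun j k hjk => ?_⟩
    · by_cases h : j = i
      · subst h; rw [Pi.single_eq_same]; exact t.2
      · simp [h]
    · by_cases h : j = i
      · right; simp [show k ≠ i from fun hk => hjk (h.trans hk.symm)]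
      · left; simp [h]⟩

/-- The `k`th coordinate of a particle travelling around `S_3`. -/
def orbitCoord (s : S1) (k : Fin 3) : ℝ :=
  max 0 (min 1 (2 - 12 * ‖s - (((k : ℕ) : ℝ) / 3 : ℝ)‖))

lemma orbitCoord_eq_zero {s : S1} {k : Fin 3}
    (h : 1 / 6 ≤ ‖s - (((k : ℕ) : ℝ) / 3 : ℝ)‖) : orbitCoord s k = 0 := by
  unfold orbitCoord
  exact max_eq_left ((min_le_right _ _).trans (by linarith))

lemma orbitCoord_eq_one {s : S1} {k : Fin 3}
    (h : ‖s - (((k : ℕ) : ℝ) / 3 : ℝ)‖ ≤ 1 / 12) : orbitCoord s k = 1 := by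
  unfold orbitCoord
  rw [min_eq_left (by linarith)]
  norm_num

lemma orbitCoord_mem (s : S1) : orbitCoord s ∈ starSet 3 := by
  refine ⟨fun i => ⟨le_max_left _ _, max_le zero_le_one (min_le_left _ _)⟩, fun i j hij => ?_⟩
  by_contra! hne
  have hi := lt_of_not_ge (fun h => hne.1 (orbitCoord_eq_zero h))
  have hj := lt_of_not_ge (fun h => hne.2 (orbitCoord_eq_zero h))
  induction s using QuotientAddGroup.induction_on with | H x =>
  rw [← AddCircle.coe_sub, UnitAddCircle.norm_eq, abs_lt] at hi hj
  obtain ⟨hi1, hi2⟩ := hi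
  obtain ⟨hj1, hj2⟩ := hj
  generalize round (x - ((i : ℕ) : ℝ) / 3) = m at *
  generalize round (x - ((j : ℕ) : ℝ) / 3) = n at *
  have h1 : (((j : ℕ) : ℤ) - ((i : ℕ) : ℤ) + 3 * (n - m) : ℤ) < 1 := by
    have : ((((j : ℕ) : ℤ) - ((i : ℕ) : ℤ) + 3 * (n - m) : ℤ) : ℝ) < 1 := by
      push_cast; linarith
    exact_mod_cast this
  have h2 : -1 < (((j : ℕ) : ℤ) - ((i : ℕ) : ℤ) + 3 * (n - m) : ℤ) := by
    have : (-1 : ℝ) < ((((j : ℕ) : ℤ) - ((i : ℕ) : ℤ) + 3 * (n - m) : ℤ) : ℝ) := by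
      push_cast; linarith
    exact_mod_cast this
  apply hij
  ext
  omega

/-- The position, at time `s ∈ ℝ / ℤ`, of a particle travelling around `S_3`. The particle rests at
the end of leg `k` while `s` is within `1 / 12` of `k / 3`, and between these resting periods it
moves at constant speed along leg `k` to the centre and out along leg `k + 1`. -/
def orbit (s : S1) : StarGraph 3 := ⟨orbitCoord s, orbitCoord_mem s⟩

lemma continuous_orbit : Continuous orbit := by
  refine Continuous.subtype_mk (continuous_pi fun k => ?_) _
  unfold orbitCoord
  fun_prop

lemma orbit_ne (s : S1) : orbit s ≠ orbit (s + ((1 / 2 : ℝ) : S1)) := by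
  have half : ((1 / 2 : ℝ) : S1) + ((1 / 2 : ℝ) : S1) = 0 := by
    rw [← AddCircle.coe_add]; norm_num
  have key : ∀ (s : S1) (k : Fin 3), ‖s - (((k : ℕ) : ℝ) / 3 : ℝ)‖ ≤ 1 / 12 →
      orbit s ≠ orbit (s + ((1 / 2 : ℝ) : S1)) := by
    intro s k hk h
    have h1 : orbitCoord s k = orbitCoord (s + ((1 / 2 : ℝ) : S1)) k :=
      congrFun (congrArg Subtype.val h) k
    have hh : ‖((1 / 2 : ℝ) : S1)‖ = 1 / 2 := by
      simpa using AddCircle.norm_half_period_eq (1 : ℝ)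
    have h2 := norm_sub_le (s + ((1 / 2 : ℝ) : S1) - (((k : ℕ) : ℝ) / 3 : ℝ))
      (s - (((k : ℕ) : ℝ) / 3 : ℝ))
    rw [show s + ((1 / 2 : ℝ) : S1) - (((k : ℕ) : ℝ) / 3 : ℝ) - (s - (((k : ℕ) : ℝ) / 3 : ℝ)) =
      ((1 / 2 : ℝ) : S1) by abel, hh] at h2
    rw [orbitCoord_eq_one hk, orbitCoord_eq_zero (by linarith)] at h1
    exact one_ne_zero h1
  have near : ∀ (x : ℝ) (l : ℤ), |x - l / 3| ≤ 1 / 12 →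
      ∃ k : Fin 3, ‖(x : S1) - (((k : ℕ) : ℝ) / 3 : ℝ)‖ ≤ 1 / 12 := by
    intro x l hl
    refine ⟨⟨(l % 3).toNat, by omega⟩, ?_⟩
    have e : (((l % 3).toNat : ℕ) : ℤ) = l - 3 * (l / 3) := by omega
    have e' : (((l % 3).toNat : ℕ) : ℝ) = l - 3 * ((l / 3 : ℤ) : ℝ) := by exact_mod_cast e
    rw [← AddCircle.coe_sub, UnitAddCircle.norm_eq]
    refine (round_le _ (l / 3)).trans ?_
    dsimp only
    rw [e']
    rwa [show x - ((l : ℝ) - 3 * ((l / 3 : ℤ) : ℝ)) / 3 - ((l / 3 : ℤ) : ℝ) = x - l / 3 by ring]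
  induction s using QuotientAddGroup.induction_on with | H x =>
  have hr := abs_le.1 (abs_sub_round (6 * x))
  rcases Int.even_or_odd' (round (6 * x)) with ⟨l, hl | hl⟩
  · rw [hl] at hr
    push_cast at hr
    obtain ⟨k, hk⟩ := near x l (abs_le.2 ⟨by linarith, by linarith⟩)
    exact key _ k hk
  · rw [hl] at hr
    push_cast at hr
    obtain ⟨k, hk⟩ := near (x + 1 / 2) (l + 2)
      (abs_le.2 ⟨by push_cast; linarith, by push_cast; linarith⟩)
    rw [AddCircle.coe_add] at hk
    have := key _ k hk
    rw [add_assoc, half, add_zero] at this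
    exact this.symm

/-- The canonical loop `S¹ → F_2(S_3)`: two particles follow the same itinerary, half a period
apart, so that at each time one of them rests at the end of a leg and the two orbit each other,
counterclockwise when the legs `0, 1, 2` are drawn in counterclockwise order in the plane. It is
equivariant for the antipodal action on `S¹` and the exchange of the two particles. -/
def orderedStarLoop : C(S1, OrdConf 2 (StarGraph 3)) where
  toFun s := ⟨![orbit s, orbit (s + ((1 / 2 : ℝ) : S1))], by
    have h := orbit_ne s
    intro i j hij
    fin_cases i <;> fin_cases j <;> simp_all [Ne.symm]⟩
  continuous_toFun := by
    refine Continuous.subtype_mk (continuous_pi fun i => ?_) _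
    fin_cases i
    · exact continuous_orbit
    · exact continuous_orbit.comp (continuous_id.add continuous_const)

lemma orderedStarLoop_periodic : Function.Periodic
    (fun t : ℝ => (⟦orderedStarLoop ((t / 2 : ℝ) : S1)⟧ : UnordConf 2 (StarGraph 3))) 1 := by
  intro t
  refine Quotient.sound ⟨Equiv.swap 0 1, fun i => ?_⟩
  have e : (((t + 1) / 2 : ℝ) : S1) = ((t / 2 : ℝ) : S1) + ((1 / 2 : ℝ) : S1) := by
    rw [← AddCircle.coe_add]; congr 1; ring
  have half : ((1 / 2 : ℝ) : S1) + ((1 / 2 : ℝ) : S1) = 0 := by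
    rw [← AddCircle.coe_add]; norm_num
  fin_cases i
  · change orbit ((t / 2 : ℝ) : S1) =
      orbit ((((t + 1) / 2 : ℝ) : S1) + ((1 / 2 : ℝ) : S1))
    rw [e, add_assoc, half, add_zero]
  · change orbit (((t / 2 : ℝ) : S1) + ((1 / 2 : ℝ) : S1)) = orbit (((t + 1) / 2 : ℝ) : S1)
    rw [e]

/-- The canonical loop `S¹ → B_2(S_3)`, obtained from `orderedStarLoop` by passing to the quotient
by the antipodal action on the source (the quotient circle being again parametrised by `ℝ / ℤ`,
via `t ↦ t / 2`) and by the exchange of the particles on the target. -/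
def starLoop : C(S1, UnordConf 2 (StarGraph 3)) where
  toFun := orderedStarLoop_periodic.lift
  continuous_toFun := by
    refine continuous_coinduced_dom.mpr ?_
    change Continuous fun t : ℝ =>
      (⟦orderedStarLoop ((t / 2 : ℝ) : S1)⟧ : UnordConf 2 (StarGraph 3))
    exact continuous_quotient_mk'.comp (orderedStarLoop.continuous.comp
      ((AddCircle.continuous_mk' 1).comp (continuous_id.div_const 2)))

/-- The star class in `H₁(B_2(X))` determined by a topological embedding `φ : S_3 → X`: the image of
the fundamental class of `S¹` under `S¹ → B_2(S_3) → B_2(X)`. -/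
def starClass {X : Type} [TopologicalSpace X] (φ : C(StarGraph 3, X)) (hφ : IsEmbedding φ) :
    H1 (UnordConf 2 X) :=
  (H1map ((unordConfMap 2 φ hφ.injective).comp starLoop)).hom fundamentalClass

/-! ### The theta graph in the plane -/

/-- The theta graph `Θ_3`, the suspension of a three-point set, drawn piecewise linearly in the
plane: with `{-1, 0, 1}` as the three-point set, the point at height `y ∈ [-1, 1]` of the suspension
of `k` is drawn at `(k (1 - |y|), y)`. Thus the two vertices are `(0, 1)` and `(0, -1)`, and they
are joined by three edges, through `(-1, 0)`, `(0, 0)` and `(1, 0)`. -/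
def thetaSet : Set ℂ :=
  {z | |z.im| ≤ 1 ∧ ∃ k : ℝ, (k = -1 ∨ k = 0 ∨ k = 1) ∧ z.re = k * (1 - |z.im|)}

/-- The theta graph as a topological space. -/
abbrev Theta : Type := thetaSet

/-- The top vertex of the theta graph. -/
def thetaTop : Theta := ⟨Complex.I, by simp [thetaSet]⟩

/-- The bottom vertex of the theta graph. -/
def thetaBottom : Theta := ⟨-Complex.I, by simp [thetaSet]⟩

/-- A map `φ : S_3 → ℂ` is oriented counterclockwise at the central vertex if the legs `0, 1, 2`
leave the image of the central vertex in directions `exp(i θ₀), exp(i θ₁), exp(i θ₂)` occurring in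
this cyclic order counterclockwise around that point. -/
def IsCounterclockwise (φ : StarGraph 3 → ℂ) : Prop :=
  ∃ θ : Fin 3 → ℝ, θ 0 < θ 1 ∧ θ 1 < θ 2 ∧ θ 2 < θ 0 + 2 * Real.pi ∧
    ∀ i, Tendsto
      (fun t : unitInterval => (φ (starLeg i t) - φ (starCenter 3)) /
        (‖φ (starLeg i t) - φ (starCenter 3)‖ : ℂ))
      (𝓝[>] 0) (𝓝 (Complex.exp (θ i * Complex.I)))

/-- `c` is a star class at the point `v` of the theta graph, oriented counterclockwise: it is the
star class of some topological embedding `S_3 → Θ_3` that takes the central vertex to `v` and is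
oriented counterclockwise there. -/
def IsCounterclockwiseStarClass (v : Theta) (c : H1 (UnordConf 2 Theta)) : Prop :=
  ∃ (φ : C(StarGraph 3, Theta)) (hφ : IsEmbedding φ), φ (starCenter 3) = v ∧
    IsCounterclockwise (fun x => (φ x : ℂ)) ∧ c = starClass φ hφ

end

/-! Homology embeds in singular 1-chains modulo boundaries, where paths that are not closed also
have classes. There a star class becomes the class of one path, and that path can be cut into
pieces, reversed and pushed across 2-simplices (`segClass_add`).

Uniqueness at the top vertex (`starSeg_eq_topStar`): shrinking the star pushes it into the upper
half of the graph, where each leg runs monotonically down a single edge. A straight-line isotopy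
then turns it into the linear star with the same three slopes. The counterclockwise condition
determines the slopes up to cyclic order, and a cyclic relabelling of the legs only rotates the
loop. The bottom vertex follows by the half turn `z ↦ -z`, which preserves orientation.

The heart is `starSeg_neg_topStar`, the equality of the standard top star with its half turn. Each
loop is a sum of six moves, in which one particle passes between a vertex and one of the axis points
`-1`, `0`, `1` while the other rests at an axis point. With every move directed towards the vertex,
the top class is `A (-1) - A 1` and the bottom class is `B (-1) - B 1`, where `A s` collects the top
moves attached to the outer edge `s` and `B s` the corresponding bottom ones. Commuting moves in the
upper half of one edge with moves in the lower half of another gives `A s = B s + D` with `D`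
independent of `s` (`moves_top_eq_moves_bottom`), so `D` cancels. -/

noncomputable section

/-! ### One-chains modulo boundaries -/

section ChainClasses

open scoped Simplicial

/-- Naturality of `homologyι`, together with the fact that cycles to homology to opcycles is the
same map as cycles to chains to opcycles. -/
lemma SSet.liftCycles_homologyMap_homologyι {S T : SSet.{0}} (F : S ⟶ T) (x : S _⦋1⦌)
    (hx : S.ιChainComplex x ≫ (S.chainComplex (ModuleCat.of ℤ ℤ)).d 1 0 = 0) :
    ((S.chainComplex (ModuleCat.of ℤ ℤ)).liftCycles (S.ιChainComplex x) 0 (by simp) hx ≫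
      (S.chainComplex (ModuleCat.of ℤ ℤ)).homologyπ 1) ≫
        HomologicalComplex.homologyMap (SSet.chainComplexMap F (ModuleCat.of ℤ ℤ)) 1 ≫
          (T.chainComplex (ModuleCat.of ℤ ℤ)).homologyι 1 =
      T.ιChainComplex (F.app (.op ⦋1⦌) x) ≫ (T.chainComplex (ModuleCat.of ℤ ℤ)).pOpcycles 1 := by
  rw [HomologicalComplex.homologyι_naturality, Category.assoc,
    HomologicalComplex.homology_π_ι_assoc, HomologicalComplex.liftCycles_i_assoc,
    HomologicalComplex.p_opcyclesMap, SSet.ι_chainComplexMap_f_assoc]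

lemma SSet.ιChainComplex_pOpcycles_boundary {S : SSet.{0}} (x : S _⦋2⦌) :
    S.ιChainComplex (S.δ 2 x) ≫ (S.chainComplex (ModuleCat.of ℤ ℤ)).pOpcycles 1 +
      S.ιChainComplex (S.δ 0 x) ≫ (S.chainComplex (ModuleCat.of ℤ ℤ)).pOpcycles 1 =
      S.ιChainComplex (S.δ 1 x) ≫ (S.chainComplex (ModuleCat.of ℤ ℤ)).pOpcycles 1 := by
  have h := S.ιChainComplex x ≫=
    (S.chainComplex (ModuleCat.of ℤ ℤ)).d_pOpcycles 2 1
  rw [SSet.ιChainComplex_d_assoc, Fin.sum_univ_three] at h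
  simp only [Preadditive.add_comp, Fin.val_zero, Fin.val_one, Fin.val_two, pow_zero, pow_one,
    one_smul, neg_smul, Limits.comp_zero,
    Preadditive.neg_comp, even_two, Even.neg_one_pow] at h
  rw [← sub_eq_zero, ← h]
  abel

/-- Singular `1`-chains of `X` modulo boundaries. -/
abbrev ChainClass (X : Type) [TopologicalSpace X] : ModuleCat.{0} ℤ :=
  ((TopCat.toSSet.obj (TopCat.of X)).chainComplex (ModuleCat.of ℤ ℤ)).opcycles 1

variable {X : Type} [TopologicalSpace X]

/-- The class modulo boundaries of a singular `1`-simplex. -/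
def simplexClass (f : C(stdSimplex ℝ (Fin 2), X)) : ChainClass X :=
  ((TopCat.toSSet.obj (TopCat.of X)).ιChainComplex
      ((TopCat.toSSetObjEquiv (TopCat.of X) (.op ⦋1⦌)).symm f) ≫
    ((TopCat.toSSet.obj (TopCat.of X)).chainComplex (ModuleCat.of ℤ ℤ)).pOpcycles 1).hom (1 : ℤ)

/-- The inclusion of homology into chains modulo boundaries. -/
def homologyToChainClass (X : Type) [TopologicalSpace X] : H1 X ⟶ ChainClass X :=
  ((TopCat.toSSet.obj (TopCat.of X)).chainComplex (ModuleCat.of ℤ ℤ)).homologyι 1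

lemma homologyToChainClass_injective : Function.Injective (homologyToChainClass X).hom := by
  have : Mono (homologyToChainClass X) := by
    unfold homologyToChainClass
    exact inferInstanceAs (Mono (HomologicalComplex.homologyι _ _))
  exact (ModuleCat.mono_iff_injective _).1 this

lemma homologyToChainClass_H1map (f : C(S1, X)) :
    (homologyToChainClass X).hom ((H1map f).hom fundamentalClass) =
      simplexClass (f.comp ((TopCat.toSSetObjEquiv (TopCat.of S1) (.op ⦋1⦌)) circleSimplex)) :=
  congrArg (fun g => g.hom (1 : ℤ)) (SSet.liftCycles_homologyMap_homologyι
    (TopCat.toSSet.map (TopCat.ofHom f)) circleSimplex (by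
      rw [SSet.ιChainComplex_d, Fin.sum_univ_two, circleSimplex_face 1 0]
      simp))

lemma simplexClass_boundary (τ : C(stdSimplex ℝ (Fin 3), X)) :
    simplexClass (τ.comp ⟨stdSimplex.map (Fin.succAbove 2), stdSimplex.continuous_map _⟩) +
      simplexClass (τ.comp ⟨stdSimplex.map (Fin.succAbove 0), stdSimplex.continuous_map _⟩) =
      simplexClass (τ.comp ⟨stdSimplex.map (Fin.succAbove 1), stdSimplex.continuous_map _⟩) :=
  congrArg (fun g => g.hom (1 : ℤ)) (SSet.ιChainComplex_pOpcycles_boundary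
    ((TopCat.toSSetObjEquiv (TopCat.of X) (.op ⦋2⦌)).symm τ))

end ChainClasses

/-! ### Classes of parametrised segments -/

section Segments

variable {X : Type} [TopologicalSpace X] {E F : Type*} [AddCommGroup E] [Module ℝ E]
  [AddCommGroup F] [Module ℝ F]

open Classical in
/-- The class modulo boundaries of the singular simplex obtained by restricting `f` to the segment
from `P` to `Q` (zero if `f` is not continuous along it). -/
def segClass (f : E → X) (P Q : E) : ChainClass X :=
  if h : Continuous fun x : stdSimplex ℝ (Fin 2) => f (x.1 0 • P + x.1 1 • Q) then
    simplexClass ⟨_, h⟩ else 0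

/-- No continuity is needed: if one side takes the default value `0`, so does the other. The two
ambient spaces may differ, which lets a stretch of time in `ℝ` be compared with a segment in `ℂ ×
ℂ`. -/
lemma segClass_congr {f : E → X} {g : F → X} {P Q : E} {P' Q' : F}
    (h : ∀ s t : ℝ, 0 ≤ s → 0 ≤ t → s + t = 1 → f (s • P + t • Q) = g (s • P' + t • Q')) :
    segClass f P Q = segClass g P' Q' := by
  have e : (fun x : stdSimplex ℝ (Fin 2) => f (x.1 0 • P + x.1 1 • Q)) =
      fun x : stdSimplex ℝ (Fin 2) => g (x.1 0 • P' + x.1 1 • Q') :=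
    funext fun x => h _ _ (x.2.1 0) (x.2.1 1) (by simpa [Fin.sum_univ_two] using x.2.2)
  unfold segClass
  by_cases hc : Continuous fun x : stdSimplex ℝ (Fin 2) => g (x.1 0 • P' + x.1 1 • Q')
  · rw [dif_pos hc, dif_pos (e ▸ hc)]
    congr 1
    ext x
    exact congrFun e x
  · rw [dif_neg hc, dif_neg (e ▸ hc)]

lemma segClass_eq {f : E → X} {P Q : E} (g : C(stdSimplex ℝ (Fin 2), X))
    (h : ∀ x, g x = f (x.1 0 • P + x.1 1 • Q)) : segClass f P Q = simplexClass g := by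
  have e : (fun x : stdSimplex ℝ (Fin 2) => f (x.1 0 • P + x.1 1 • Q)) = g :=
    funext fun x => (h x).symm
  unfold segClass
  rw [dif_pos (e ▸ g.continuous)]
  congr 1
  ext x
  exact congrFun e x

variable [TopologicalSpace E] [IsTopologicalAddGroup E] [ContinuousSMul ℝ E]

lemma stdSimplex.map_apply_eq_sum {ι κ : Type*} [Fintype ι] [Fintype κ] [DecidableEq κ] (f : ι → κ)
    (x : stdSimplex ℝ ι) (j : κ) :
    (stdSimplex.map f x).1 j = ∑ i, if f i = j then x.1 i else 0 := by
  change FunOnFinite.linearMap ℝ ℝ f x.1 j = _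
  rw [FunOnFinite.linearMap_apply_apply, Finset.sum_filter]

/-- The triangle `P Q R` stays in the convex set `S`, so `f` on it is a singular 2-simplex whose
faces are the three segments. -/
lemma segClass_add {f : E → X} {S : Set E} (hf : ContinuousOn f S) (hS : Convex ℝ S) {P Q R : E}
    (hP : P ∈ S) (hQ : Q ∈ S) (hR : R ∈ S) :
    segClass f P Q + segClass f Q R = segClass f P R := by
  have hc : Continuous fun x : stdSimplex ℝ (Fin 3) => x.1 0 • P + x.1 1 • Q + x.1 2 • R := by
    have hi : ∀ i, Continuous fun x : stdSimplex ℝ (Fin 3) => x.1 i := fun i =>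
      (continuous_apply i).comp continuous_subtype_val
    exact (((hi 0).smul continuous_const).add ((hi 1).smul continuous_const)).add
      ((hi 2).smul continuous_const)
  have hτ : Continuous fun x : stdSimplex ℝ (Fin 3) => f (x.1 0 • P + x.1 1 • Q + x.1 2 • R) := by
    refine hf.comp_continuous hc fun x => ?_
    have := hS.sum_mem (t := Finset.univ) (w := x.1) (z := ![P, Q, R]) (fun i _ => x.2.1 i) x.2.2
      (by intro i _; fin_cases i <;> assumption)
    simpa [Fin.sum_univ_three] using this
  have key := simplexClass_boundary ⟨_, hτ⟩
  rw [← segClass_eq (f := f) (P := P) (Q := Q), ← segClass_eq (f := f) (P := Q) (Q := R),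
    ← segClass_eq (f := f) (P := P) (Q := R)] at key
  · exact key
  all_goals
    intro x
    simp only [ContinuousMap.comp_apply, ContinuousMap.coe_mk, stdSimplex.map_apply_eq_sum,
      Fin.sum_univ_two]
    simp [Fin.succAbove]

lemma segClass_self (f : E → X) (P : E) : segClass f P P = 0 := by
  have := segClass_add (f := f) (continuousOn_singleton f P) (convex_singleton P) rfl rfl rfl
  simpa using this

end Segments

lemma homologyToChainClass_H1map_eq_segClass {X : Type} [TopologicalSpace X] (f : C(S1, X)) :
    (homologyToChainClass X).hom ((H1map f).hom fundamentalClass) =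
      segClass (fun t : ℝ => f (t : S1)) 0 1 := by
  rw [homologyToChainClass_H1map]
  refine (segClass_eq _ fun x => ?_).symm
  simp only [circleSimplex, Equiv.apply_symm_apply]
  simp
  rfl

/-- Freely homotopic loops have the same class. -/
lemma segClass_eq_of_homotopy {X : Type} [TopologicalSpace X] {H : ℝ × ℝ → X} (hH : Continuous H)
    (hper : ∀ u, H (u, 0) = H (u, 1)) :
    segClass (fun t : ℝ => H (0, t)) 0 1 = segClass (fun t : ℝ => H (1, t)) 0 1 := by
  have h0 : segClass (fun t : ℝ => H (0, t)) 0 1 = segClass H (0, 0) (0, 1) :=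
    segClass_congr fun s t _ _ _ => by simp
  have h1 : segClass (fun t : ℝ => H (1, t)) 0 1 = segClass H (1, 0) (1, 1) :=
    segClass_congr fun s t _ _ h => by simp [h]
  have h2 : segClass H (0, 0) (1, 0) = segClass H (0, 1) (1, 1) :=
    segClass_congr fun s t _ _ h => by simp [h, hper]
  have add := fun P Q R => segClass_add (P := P) (Q := Q) (R := R) hH.continuousOn convex_univ
    trivial trivial trivial
  -- Both routes round the unit square equal its diagonal, and the two sides swept by the endpoints
  -- agree by `hper`.
  have e1 := add (0, 0) (0, 1) (1, 1)
  have e2 := add (0, 0) (1, 0) (1, 1)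
  rw [h0, h1, ← add_left_inj (segClass H (0, 1) (1, 1)), e1, ← e2, h2, add_comm]

/-- Reparametrising a loop by a rotation does not change its class. -/
lemma segClass_shift {X : Type} [TopologicalSpace X] {f : ℝ → X} (hf : Continuous f)
    (hper : Function.Periodic f 1) (a : ℝ) :
    segClass (fun t => f (t + a)) 0 1 = segClass f 0 1 := by
  have := segClass_eq_of_homotopy (H := fun p : ℝ × ℝ => f (p.2 + p.1 * a)) (by fun_prop)
    (fun u => by rw [show (1 : ℝ) + u * a = (0 + u * a) + 1 by ring]; exact (hper _).symm)
  simpa using this.symm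

/-! ### Loops of pairs of points of the theta graph -/

/-- The pairs of distinct points of the theta graph. -/
def thetaPairs : Set (ℂ × ℂ) := {p | p.1 ∈ thetaSet ∧ p.2 ∈ thetaSet ∧ p.1 ≠ p.2}

lemma injective_pair {X : Type*} {x y : X} (h : x ≠ y) : Function.Injective ![x, y] := by
  intro i j hij
  fin_cases i <;> fin_cases j <;> simp_all [Ne.symm]

/-- The unordered configuration on the theta graph formed by a pair of distinct points (and an
arbitrary one for other pairs). -/
def thetaConf (p : ℂ × ℂ) : UnordConf 2 Theta :=
  open Classical in
  if h : p ∈ thetaPairs then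
    ⟦⟨![⟨p.1, h.1⟩, ⟨p.2, h.2.1⟩], injective_pair fun e => h.2.2 (congrArg Subtype.val e)⟩⟧
  else
    ⟦⟨![thetaTop, thetaBottom], injective_pair fun e => by
      have := congrArg (fun z : Theta => (z : ℂ).im) e
      norm_num [thetaTop, thetaBottom] at this⟩⟧

lemma continuousOn_thetaConf : ContinuousOn thetaConf thetaPairs := by
  rw [continuousOn_iff_continuous_domRestrict]
  have e : thetaPairs.domRestrict thetaConf = fun p : thetaPairs =>
      (⟦⟨![⟨p.1.1, p.2.1⟩, ⟨p.1.2, p.2.2.1⟩],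
        injective_pair fun e => p.2.2.2 (congrArg Subtype.val e)⟩⟧ : UnordConf 2 Theta) := by
    ext p
    exact dif_pos p.2
  rw [e]
  refine continuous_quotient_mk'.comp (Continuous.subtype_mk (continuous_pi fun i => ?_) _)
  fin_cases i
  · exact Continuous.subtype_mk (continuous_fst.comp continuous_subtype_val) _
  · exact Continuous.subtype_mk (continuous_snd.comp continuous_subtype_val) _

lemma swap_mem_thetaPairs {p : ℂ × ℂ} : p.swap ∈ thetaPairs ↔ p ∈ thetaPairs := by
  simp only [thetaPairs, Set.mem_ofPred_eq, Prod.fst_swap, Prod.snd_swap, ne_comm (a := p.1)]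
  tauto

lemma thetaConf_swap (p : ℂ × ℂ) : thetaConf p.swap = thetaConf p := by
  unfold thetaConf
  by_cases h : p ∈ thetaPairs
  · rw [dif_pos h, dif_pos (swap_mem_thetaPairs.2 h)]
    refine Quotient.sound ⟨Equiv.swap 0 1, fun i => ?_⟩
    fin_cases i <;> rfl
  · rw [dif_neg h, dif_neg (mt swap_mem_thetaPairs.1 h)]

/-- The positions at time `t` of the two particles orbiting in the image of the star graph under a
map `φ` to the plane. -/
def orbitPair (φ : StarGraph 3 → ℂ) (t : ℝ) : ℂ × ℂ :=
  (φ (orbit (t / 2 : ℝ)), φ (orbit (t / 2 + 1 / 2 : ℝ)))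

/-- The class modulo boundaries of the star loop of a map `φ` from the star graph to the theta graph
in the plane. -/
def starSeg (φ : StarGraph 3 → ℂ) : ChainClass (UnordConf 2 Theta) :=
  segClass (fun t => thetaConf (orbitPair φ t)) (0 : ℝ) 1

lemma homologyToChainClass_starClass (φ : C(StarGraph 3, Theta)) (hφ : IsEmbedding φ) :
    (homologyToChainClass _).hom (starClass φ hφ) = starSeg fun x => φ x := by
  unfold starClass starSeg
  rw [homologyToChainClass_H1map_eq_segClass]
  congr 1
  ext t
  have h : orbitPair (fun x => (φ x : ℂ)) t ∈ thetaPairs := by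
    refine ⟨(φ _).2, (φ _).2, fun e => ?_⟩
    have := hφ.injective (Subtype.ext e)
    rw [AddCircle.coe_add] at this
    exact orbit_ne _ this
  rw [thetaConf, dif_pos h]
  refine Quotient.sound ⟨1, fun i => ?_⟩
  fin_cases i
  · rfl
  · exact congrArg (fun s => φ (orbit s)) (AddCircle.coe_add 1 _ _)

lemma orbitPair_mem {φ : StarGraph 3 → ℂ} (hφ : Function.Injective φ) (hm : ∀ x, φ x ∈ thetaSet)
    (t : ℝ) : orbitPair φ t ∈ thetaPairs := by
  refine ⟨hm _, hm _, fun e => ?_⟩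
  have := hφ e
  rw [AddCircle.coe_add] at this
  exact orbit_ne _ this

/-- One period of the loop is half of the itinerary, after which the particles have exchanged
places. Only the unordered pair is 1-periodic. -/
lemma orbitPair_add_one (φ : StarGraph 3 → ℂ) (t : ℝ) :
    orbitPair φ (t + 1) = (orbitPair φ t).swap := by
  unfold orbitPair
  have h : (((t + 1) / 2 + 1 / 2 : ℝ) : S1) = ((t / 2 : ℝ) : S1) := by
    rw [show (t + 1) / 2 + 1 / 2 = t / 2 + 1 by ring, AddCircle.coe_add_period]
  rw [h, show (t + 1) / 2 = t / 2 + 1 / 2 by ring]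
  rfl

lemma thetaConf_orbitPair_periodic (φ : StarGraph 3 → ℂ) :
    Function.Periodic (fun t => thetaConf (orbitPair φ t)) 1 := fun t => by
  simp only [orbitPair_add_one, thetaConf_swap]

lemma continuous_orbit_coe : Continuous fun t : ℝ => orbit (t : S1) :=
  continuous_orbit.comp (AddCircle.continuous_mk' 1)

/-- Injectivity at each stage keeps the two particles apart, so an isotopy of stars is a free
homotopy of loops. The parameter ranges over all of `ℝ`, so isotopies over `[0, 1]` are extended by
clamping with `Set.projIcc`. -/
lemma starSeg_eq_of_isotopy {Φ : ℝ → StarGraph 3 → ℂ} (hc : Continuous fun p : ℝ × _ => Φ p.1 p.2)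
    (hinj : ∀ u, Function.Injective (Φ u)) (hmem : ∀ u x, Φ u x ∈ thetaSet) :
    starSeg (Φ 0) = starSeg (Φ 1) := by
  refine segClass_eq_of_homotopy (H := fun p : ℝ × ℝ => thetaConf (orbitPair (Φ p.1) p.2)) ?_
    fun u => by simpa using (thetaConf_orbitPair_periodic (Φ u) 0).symm
  refine continuousOn_thetaConf.comp_continuous (.prodMk ?_ ?_)
    fun p => orbitPair_mem (hinj _) (hmem _) _
  · exact hc.comp (continuous_fst.prodMk (continuous_orbit_coe.comp (by fun_prop)))
  · exact hc.comp (continuous_fst.prodMk (continuous_orbit_coe.comp (by fun_prop)))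

/-- The cyclic permutation of the legs of the star graph. -/
def starRot (x : StarGraph 3) : StarGraph 3 :=
  ⟨fun k => x.1 (k - 1), fun i => x.2.1 _, fun i j hij => x.2.2 _ _ fun h => hij (by simpa using h)⟩

lemma orbit_add_third (s : S1) : orbit (s + ((1 / 3 : ℝ) : S1)) = starRot (orbit s) := by
  refine Subtype.ext (funext fun k => ?_)
  change orbitCoord _ k = orbitCoord s (k - 1)
  unfold orbitCoord
  suffices h : s + ((1 / 3 : ℝ) : S1) - (((k : ℕ) : ℝ) / 3 : ℝ) =
      s - ((((k - 1 : Fin 3) : ℕ) : ℝ) / 3 : ℝ) by rw [h]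
  have key : ((((k : ℕ) : ℝ) / 3 : ℝ) : S1) - ((1 / 3 : ℝ) : S1) =
      (((((k - 1 : Fin 3) : ℕ) : ℝ) / 3 : ℝ) : S1) := by
    rw [← AddCircle.coe_sub]
    fin_cases k
    · rw [← AddCircle.coe_add_period]
      congr 1
      norm_num
    · congr 1
      norm_num
    · congr 1
      change ((2 : ℕ) : ℝ) / 3 - 1 / 3 = ((1 : ℕ) : ℝ) / 3
      norm_num
  rw [← key]
  abel

lemma starSeg_comp_starRot {φ : StarGraph 3 → ℂ} (hc : Continuous φ) (hφ : Function.Injective φ)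
    (hm : ∀ x, φ x ∈ thetaSet) : starSeg (φ ∘ starRot) = starSeg φ := by
  have hcont : Continuous fun t => thetaConf (orbitPair φ t) := by
    refine continuousOn_thetaConf.comp_continuous (.prodMk ?_ ?_) (orbitPair_mem hφ hm)
    · exact hc.comp (continuous_orbit_coe.comp (by fun_prop))
    · exact hc.comp (continuous_orbit_coe.comp (by fun_prop))
  -- The loop runs through the itinerary at half speed, so a third of the itinerary is a shift by `2
  -- / 3`.
  rw [starSeg, starSeg, ← segClass_shift hcont (thetaConf_orbitPair_periodic φ) (2 / 3)]
  congr 1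
  ext t
  congr 1
  simp only [orbitPair, Function.comp_apply, ← orbit_add_third, ← AddCircle.coe_add]
  rw [show t / 2 + 1 / 3 = (t + 2 / 3) / 2 by ring,
    show t / 2 + 1 / 2 + 1 / 3 = (t + 2 / 3) / 2 + 1 / 2 by ring]

/-! ### Embeddings of the star graph near a vertex of the theta graph -/

lemma exists_eq_starLeg (x : StarGraph 3) : ∃ i t, x = starLeg i t := by
  by_cases h : ∃ i, x.1 i ≠ 0
  · obtain ⟨i, hi⟩ := h
    refine ⟨i, ⟨x.1 i, x.2.1 i⟩, Subtype.ext (funext fun j => ?_)⟩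
    by_cases hj : j = i
    · subst hj
      simp [starLeg]
    · simpa [starLeg, hj] using (x.2.2 j i hj).resolve_right hi
  · push Not at h
    exact ⟨0, 0, Subtype.ext (funext fun j => by simp [starLeg, h])⟩

lemma starLeg_zero {n : ℕ} (i : Fin n) : starLeg i 0 = starCenter n :=
  Subtype.ext (by simp [starLeg, starCenter])

/-- Scaling of the star graph towards its centre. -/
def starScale {n : ℕ} (s : unitInterval) (x : StarGraph n) : StarGraph n :=
  ⟨fun i => s * x.1 i, fun i => ⟨mul_nonneg s.2.1 (x.2.1 i).1,
    mul_le_one₀ s.2.2 (x.2.1 i).1 (x.2.1 i).2⟩,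
    fun i j hij => (x.2.2 i j hij).imp (fun h => by simp [h]) (fun h => by simp [h])⟩

lemma continuous_starScale {n : ℕ} :
    Continuous fun p : unitInterval × StarGraph n => starScale p.1 p.2 := by
  refine Continuous.subtype_mk (continuous_pi fun i => ?_) _
  exact (continuous_subtype_val.comp continuous_fst).mul
    ((continuous_apply i).comp (continuous_subtype_val.comp continuous_snd))

lemma starScale_injective {n : ℕ} {s : unitInterval} (hs : 0 < s) :
    Function.Injective (starScale (n := n) s) := fun _ _ h =>
  Subtype.ext (funext fun i => mul_left_cancel₀ (a := (s : ℝ)) (ne_of_gt hs)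
    (congrFun (congrArg Subtype.val h) i))

lemma starScale_starLeg {n : ℕ} (s t : unitInterval) (i : Fin n) :
    starScale s (starLeg i t) = starLeg i (s * t) := by
  refine Subtype.ext (funext fun j => ?_)
  by_cases hj : j = i
  · subst hj
    simp [starLeg, starScale]
  · simp [starLeg, starScale, hj]

lemma starScale_one {n : ℕ} (x : StarGraph n) : starScale 1 x = x :=
  Subtype.ext (funext fun j => by simp [starScale])

lemma starScale_center {n : ℕ} (s : unitInterval) : starScale s (starCenter n) = starCenter n :=
  Subtype.ext (funext fun j => by simp [starScale, starCenter])

lemma starSeg_comp_starScale {φ : StarGraph 3 → ℂ} (hc : Continuous φ) (hφ : Function.Injective φ)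
    (hm : ∀ x, φ x ∈ thetaSet) {ε : unitInterval} (hε : 0 < ε) :
    starSeg (fun x => φ (starScale ε x)) = starSeg φ := by
  have := starSeg_eq_of_isotopy
    -- The maximum keeps the factor positive, hence the scaling injective, while it goes from `ε` to
    -- `1`.
    (Φ := fun u x => φ (starScale (max ε (Set.projIcc 0 1 zero_le_one u)) x))
    (hc.comp (continuous_starScale.comp (((continuous_const.max
      (continuous_projIcc.comp continuous_fst))).prodMk continuous_snd)))
    (fun u => hφ.comp (starScale_injective (hε.trans_le (le_max_left _ _)))) fun u x => hm _
  have h0 : max ε (0 : unitInterval) = ε := max_eq_left ε.2.1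
  have h1 : max ε (1 : unitInterval) = 1 := max_eq_right ε.2.2
  have e0 : Set.projIcc (0 : ℝ) 1 zero_le_one 0 = 0 := Set.projIcc_left _
  have e1 : Set.projIcc (0 : ℝ) 1 zero_le_one 1 = 1 := Set.projIcc_right _
  simpa only [h0, h1, e0, e1, starScale_one] using this

lemma IsCounterclockwise.comp_starScale {φ : StarGraph 3 → ℂ} (h : IsCounterclockwise φ)
    {ε : unitInterval} (hε : 0 < ε) : IsCounterclockwise fun x => φ (starScale ε x) := by
  obtain ⟨θ, h1, h2, h3, h4⟩ := h
  refine ⟨θ, h1, h2, h3, fun i => ?_⟩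
  have ht : Tendsto (fun t : unitInterval => ε * t) (𝓝[>] 0) (𝓝[>] 0) := by
    refine tendsto_nhdsWithin_iff.2 ⟨?_, ?_⟩
    · have : Continuous fun t : unitInterval => ε * t := continuous_const.mul continuous_id
      simpa using this.continuousAt.tendsto.mono_left (nhdsWithin_le_nhds (a := 0))
    · filter_upwards [self_mem_nhdsWithin] with t ht
      exact mul_pos hε ht
  simpa only [Function.comp_def, starScale_starLeg, starScale_center] using (h4 i).comp ht

lemma exists_starScale_im_pos {φ : StarGraph 3 → ℂ} (hc : Continuous φ)
    (h0 : φ (starCenter 3) = Complex.I) :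
    ∃ ε : unitInterval, 0 < ε ∧ ∀ x, 0 < (φ (starScale ε x)).im := by
  have hopen : IsOpen {x | 0 < (φ x).im} :=
    isOpen_lt continuous_const (Complex.continuous_im.comp hc)
  obtain ⟨δ, hδ, hball⟩ := Metric.isOpen_iff.1 hopen (starCenter 3) (by simp [h0])
  -- Coordinates are at most `1` and the distance is the sup distance, so this factor puts the whole
  -- star in the ball.
  have hpos : 0 < min 1 (δ / 2) := lt_min one_pos (half_pos hδ)
  refine ⟨⟨min 1 (δ / 2), hpos.le, min_le_left _ _⟩, hpos, fun x => hball ?_⟩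
  rw [Metric.mem_ball]
  refine lt_of_le_of_lt ?_ (half_lt_self hδ)
  refine (dist_pi_le_iff (half_pos hδ).le).2 fun i => ?_
  have h1 := x.2.1 i
  simp only [starScale, starCenter, Pi.zero_apply, Real.dist_eq, sub_zero]
  rw [abs_of_nonneg (mul_nonneg hpos.le h1.1)]
  exact (mul_le_of_le_one_right hpos.le h1.2).trans (min_le_right _ _)

/-- The slopes of the three edges of the theta graph. -/
def edgeSlopes : Set ℝ := {k | k = -1 ∨ k = 0 ∨ k = 1}

lemma add_mul_slope_mem_thetaSet {k δ : ℝ} (hk : k ∈ edgeSlopes) (h0 : 0 ≤ δ) (h1 : δ ≤ 1) :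
    Complex.I + δ * (k - Complex.I) ∈ thetaSet := by
  have : |1 - δ| = 1 - δ := abs_of_nonneg (by linarith)
  refine ⟨?_, k, hk, ?_⟩
  · simp [← sub_eq_add_neg, this, h0]
  · simp [← sub_eq_add_neg, this, mul_comm]

lemma eq_add_mul_slope_of_re {z : ℂ} {k : ℝ} (h : z.re = k * (1 - z.im)) :
    z = Complex.I + (1 - z.im : ℝ) * (k - Complex.I) := by
  apply Complex.ext <;> simp [h, mul_comm]

/-- Rays from `I` with different slopes meet only at `I`, which each leg reaches only at the centre.
-/
lemma injective_of_legs {F : StarGraph 3 → ℂ} {k : Fin 3 → ℝ} {δ : Fin 3 → unitInterval → ℝ}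
    (hk : Function.Injective k) (h0 : ∀ i, δ i 0 = 0) (hδ : ∀ i, Function.Injective (δ i))
    (hF : ∀ i t, F (starLeg i t) = Complex.I + δ i t * (k i - Complex.I)) :
    Function.Injective F := by
  intro x y h
  obtain ⟨i, t, rfl⟩ := exists_eq_starLeg x
  obtain ⟨j, t', rfl⟩ := exists_eq_starLeg y
  rw [hF, hF] at h
  have h1 := congrArg Complex.re h
  have h2 := congrArg Complex.im h
  simp at h1 h2
  rw [h2] at h1
  by_cases hij : i = j
  · subst hij
    rw [hδ i h2]
  · have hz : δ j t' = 0 := by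
      rcases mul_eq_mul_left_iff.1 h1 with h | h
      · exact absurd (hk h) hij
      · exact h
    rw [hz] at h2
    rw [hδ i (h2.trans (h0 i).symm), hδ j (hz.trans (h0 j).symm), starLeg_zero, starLeg_zero]

/-- The star at the top vertex whose legs are the upper halves of the edges with given slopes. -/
def linearStar (k : Fin 3 → ℝ) (x : StarGraph 3) : ℂ :=
  Complex.I + ∑ i, x.1 i * (k i - Complex.I)

lemma continuous_linearStar (k : Fin 3 → ℝ) : Continuous (linearStar k) := by
  refine continuous_const.add (continuous_finsetSum _ fun i _ => ?_)
  exact (Complex.continuous_ofReal.comp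
    ((continuous_apply i).comp continuous_subtype_val)).mul continuous_const

lemma linearStar_starLeg (k : Fin 3 → ℝ) (i : Fin 3) (t : unitInterval) :
    linearStar k (starLeg i t) = Complex.I + (t : ℝ) * (k i - Complex.I) := by
  unfold linearStar
  rw [Finset.sum_eq_single i]
  · simp [starLeg]
  · intro j _ hj
    simp [starLeg, hj]
  · simp

lemma linearStar_injective {k : Fin 3 → ℝ} (hk : Function.Injective k) :
    Function.Injective (linearStar k) :=
  injective_of_legs hk (δ := fun _ t => t) (fun _ => rfl) (fun _ => Subtype.val_injective)
    (linearStar_starLeg k)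

lemma linearStar_mem {k : Fin 3 → ℝ} (hk : ∀ i, k i ∈ edgeSlopes) (x : StarGraph 3) :
    linearStar k x ∈ thetaSet := by
  obtain ⟨i, t, rfl⟩ := exists_eq_starLeg x
  rw [linearStar_starLeg]
  exact add_mul_slope_mem_thetaSet (hk i) t.2.1 t.2.2

lemma linearStar_comp_starRot (k : Fin 3 → ℝ) :
    linearStar k ∘ starRot = linearStar fun i => k (i + 1) := by
  ext x
  simp only [linearStar, Function.comp_apply, starRot]
  congr 1
  exact (Fintype.sum_equiv (Equiv.addRight (1 : Fin 3)) _ _ fun i => by simp).symm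

lemma continuous_starLeg {n : ℕ} (i : Fin n) : Continuous (starLeg i) :=
  Continuous.subtype_mk ((continuous_single (A := fun _ : Fin n => ℝ) i).comp
    continuous_subtype_val) _

/-- The slope `re / (1 - im)` is undefined only at `I`, which injectivity reserves for the centre.
On the rest of the leg it is continuous on a connected set with values in a finite set, hence
constant. -/
lemma exists_slope {φ : StarGraph 3 → ℂ} (hc : Continuous φ) (hφ : Function.Injective φ)
    (hm : ∀ x, φ x ∈ thetaSet) (h0 : φ (starCenter 3) = Complex.I) (hpos : ∀ x, 0 < (φ x).im)
    (i : Fin 3) : ∃ k ∈ edgeSlopes, ∀ t : unitInterval,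
      φ (starLeg i t) = Complex.I + (1 - (φ (starLeg i t)).im : ℝ) * (k - Complex.I) := by
  have hedge : ∀ x, (φ x).im ≤ 1 ∧ ∃ k ∈ edgeSlopes, (φ x).re = k * (1 - (φ x).im) := fun x => by
    obtain ⟨h1, k, hk, h2⟩ := hm x
    rw [abs_of_pos (hpos x)] at h1 h2
    exact ⟨h1, k, hk, h2⟩
  have hne : ∀ t : unitInterval, 0 < t → 1 - (φ (starLeg i t)).im ≠ 0 := fun t ht h => by
    have him : (φ (starLeg i t)).im = 1 := by linarith
    obtain ⟨k, -, hk⟩ := (hedge (starLeg i t)).2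
    rw [h, mul_zero] at hk
    have he : φ (starLeg i t) = φ (starCenter 3) := by
      rw [h0]
      exact Complex.ext (by simp [hk]) (by simp [him])
    have := congrFun (congrArg Subtype.val (hφ he)) i
    simp only [starLeg, starCenter, Pi.single_eq_same, Pi.zero_apply] at this
    exact ht.ne' (Subtype.ext this)
  have hcl : Continuous fun t => φ (starLeg i t) := hc.comp (continuous_starLeg i)
  have hfin : edgeSlopes.Finite := (Set.toFinite {-1, 0, 1}).subset fun k hk => hk
  obtain ⟨k, hk, hconst⟩ := (isPreconnected_Ioc (a := (0 : unitInterval)) (b := 1)).eqOn_const_of_mapsTo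
    hfin.isDiscrete (f := fun t => (φ (starLeg i t)).re / (1 - (φ (starLeg i t)).im))
    (ContinuousOn.div (Complex.continuous_re.comp hcl).continuousOn
      (continuous_const.sub (Complex.continuous_im.comp hcl)).continuousOn fun t ht => hne t ht.1)
    (fun t ht => by
      obtain ⟨k, hk, h⟩ := (hedge (starLeg i t)).2
      simp only [h, mul_div_cancel_right₀ _ (hne t ht.1)]
      exact hk) ⟨0, by simp [edgeSlopes]⟩
  refine ⟨k, hk, fun t => eq_add_mul_slope_of_re ?_⟩
  rcases eq_or_lt_of_le (show 0 ≤ t from t.2.1) with rfl | ht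
  · rw [starLeg_zero, h0]
    simp
  · exact (div_eq_iff (hne t ht)).1 (hconst ⟨ht, t.2.2⟩)

/-- On each leg both maps descend the same ray from `I`, with strictly increasing depth `1 - im`.
Convex combinations of such depths are strictly increasing, so the straight-line homotopy is an
isotopy inside the graph. -/
lemma starSeg_eq_linearStar {φ : StarGraph 3 → ℂ} (hc : Continuous φ) (hφ : Function.Injective φ)
    (h0 : φ (starCenter 3) = Complex.I) (hpos : ∀ x, 0 < (φ x).im) {k : Fin 3 → ℝ}
    (hk : Function.Injective k) (hks : ∀ i, k i ∈ edgeSlopes) (hle : ∀ x, (φ x).im ≤ 1)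
    (hleg : ∀ i t, φ (starLeg i t) =
      Complex.I + (1 - (φ (starLeg i t)).im : ℝ) * (k i - Complex.I)) :
    starSeg φ = starSeg (linearStar k) := by
  have hd0 : ∀ i, 1 - (φ (starLeg i 0)).im = 0 := fun i => by simp [starLeg_zero, h0]
  have hmono : ∀ i, StrictMono fun t => 1 - (φ (starLeg i t)).im := fun i => by
    refine Continuous.strictMono_of_inj_boundedOrder (continuous_const.sub
      (Complex.continuous_im.comp (hc.comp (continuous_starLeg i)))) ?_ fun t t' htt => ?_
    · change 1 - (φ (starLeg i 0)).im ≤ 1 - (φ (starLeg i 1)).im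
      rw [hd0]
      linarith [hle (starLeg i 1)]
    · have : φ (starLeg i t) = φ (starLeg i t') := by
        rw [hleg i t, hleg i t']
        rw [show 1 - (φ (starLeg i t)).im = 1 - (φ (starLeg i t')).im from htt]
      have := congrFun (congrArg Subtype.val (hφ this)) i
      simpa [starLeg, Subtype.ext_iff] using this
  let c : ℝ → ℝ := fun u => Set.projIcc 0 1 zero_le_one u
  have hcc : Continuous c := continuous_subtype_val.comp continuous_projIcc
  have hc01 : ∀ u, 0 ≤ c u ∧ c u ≤ 1 := fun u => (Set.projIcc 0 1 zero_le_one u).2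
  have hform : ∀ u i t, (1 - c u : ℝ) * φ (starLeg i t) + c u * linearStar k (starLeg i t) =
      Complex.I + ((1 - c u) * (1 - (φ (starLeg i t)).im) + c u * t : ℝ) * (k i - Complex.I) := by
    intro u i t
    rw [linearStar_starLeg]
    nth_rewrite 1 [hleg i t]
    push_cast
    ring
  have := starSeg_eq_of_isotopy
    (Φ := fun u x => (1 - c u : ℝ) * φ x + c u * linearStar k x) ?_ ?_ ?_
  · have e0 : c 0 = 0 := congrArg Subtype.val (Set.projIcc_left (zero_le_one (α := ℝ)))
    have e1 : c 1 = 1 := congrArg Subtype.val (Set.projIcc_right (zero_le_one (α := ℝ)))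
    simpa [e0, e1] using this
  · exact ((Complex.continuous_ofReal.comp (continuous_const.sub (hcc.comp continuous_fst))).mul
      (hc.comp continuous_snd)).add ((Complex.continuous_ofReal.comp (hcc.comp continuous_fst)).mul
      ((continuous_linearStar k).comp continuous_snd))
  · intro u
    refine injective_of_legs hk (δ := fun i t => (1 - c u) * (1 - (φ (starLeg i t)).im) + c u * t)
      (fun i => by simp [hd0]) (fun i => StrictMono.injective fun t t' htt => ?_) (hform u)
    have h1 := hmono i htt
    have h2 : (t : ℝ) < t' := htt
    simp only at h1
    rcases (hc01 u).1.eq_or_lt with h | h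
    · simp [← h]
      linarith
    · have := mul_lt_mul_of_pos_left h2 h
      have := mul_le_mul_of_nonneg_left h1.le (sub_nonneg.2 (hc01 u).2)
      linarith
  · intro u x
    obtain ⟨i, t, rfl⟩ := exists_eq_starLeg x
    rw [hform]
    have h1 := hle (starLeg i t)
    have h2 := hpos (starLeg i t)
    have h3 := hc01 u
    refine add_mul_slope_mem_thetaSet (hks i) (add_nonneg (mul_nonneg (by linarith) (by linarith))
      (mul_nonneg h3.1 t.2.1)) ?_
    have := mul_le_mul_of_nonneg_left (show 1 - (φ (starLeg i t)).im ≤ 1 by linarith)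
      (sub_nonneg.2 h3.2)
    have := mul_le_mul_of_nonneg_left t.2.2 h3.1
    linarith

/-- The expression is twice the signed area of a triangle inscribed in the unit circle, with
consecutive central angles `a` and `b`. Its positivity serves as an algebraic test of cyclic order.
-/
lemma sin_cyclic_pos {a b : ℝ} (ha : 0 < a) (hb : 0 < b) (hab : a + b < 2 * Real.pi) :
    0 < Real.sin a + Real.sin b - Real.sin (a + b) := by
  have key : Real.sin a + Real.sin b - Real.sin (a + b) =
      4 * (Real.sin (a / 2) * Real.sin (b / 2) * Real.sin (a / 2 + b / 2)) := by
    obtain ⟨x, rfl⟩ : ∃ x, a = 2 * x := ⟨a / 2, by ring⟩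
    obtain ⟨y, rfl⟩ : ∃ y, b = 2 * y := ⟨b / 2, by ring⟩
    rw [mul_div_cancel_left₀ _ two_ne_zero, mul_div_cancel_left₀ _ two_ne_zero, ← mul_add,
      Real.sin_two_mul, Real.sin_two_mul, Real.sin_two_mul, Real.sin_add, Real.cos_add]
    linear_combination (-2 * Real.sin x * Real.cos x) * Real.sin_sq_add_cos_sq y +
      (-2 * Real.sin y * Real.cos y) * Real.sin_sq_add_cos_sq x
  rw [key]
  have h1 := Real.sin_pos_of_pos_of_lt_pi (half_pos ha) (by linarith)
  have h2 := Real.sin_pos_of_pos_of_lt_pi (half_pos hb) (by linarith)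
  have h3 := Real.sin_pos_of_pos_of_lt_pi (add_pos (half_pos ha) (half_pos hb)) (by linarith)
  positivity

lemma slopes_cyclic {k : Fin 3 → ℝ} (hk : ∀ i, k i ∈ edgeSlopes) {θ r : Fin 3 → ℝ}
    (h1 : θ 0 < θ 1) (h2 : θ 1 < θ 2) (h3 : θ 2 < θ 0 + 2 * Real.pi) (hr : ∀ i, 0 < r i)
    (h : ∀ i, (k i - Complex.I : ℂ) = r i * Complex.exp (θ i * Complex.I)) :
    k = ![-1, 0, 1] ∨ k = ![0, 1, -1] ∨ k = ![1, -1, 0] := by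
  have hre : ∀ i, k i = r i * Real.cos (θ i) := fun i => by
    simpa [Complex.exp_ofReal_mul_I_re] using congrArg Complex.re (h i)
  have him : ∀ i, -1 = r i * Real.sin (θ i) := fun i => by
    simpa [Complex.exp_ofReal_mul_I_im] using congrArg Complex.im (h i)
  have hsq : ∀ i, r i = √(k i ^ 2 + 1) := fun i => by
    rw [eq_comm, Real.sqrt_eq_iff_mul_self_eq_of_pos (hr i)]
    linear_combination -(r i) ^ 2 * Real.sin_sq_add_cos_sq (θ i) - (k i + r i * Real.cos (θ i)) * hre i
      + (1 - r i * Real.sin (θ i)) * him i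
  -- Both sides are the cross product of the vectors `k i - I` and `k j - I`.
  have hcross : ∀ i j, k j - k i = r i * r j * Real.sin (θ j - θ i) := fun i j => by
    rw [Real.sin_sub, hre i, hre j]
    linear_combination (-(r j * Real.cos (θ j))) * him i + (r i * Real.cos (θ i)) * him j
  have hpos := sin_cyclic_pos (sub_pos.2 h1) (sub_pos.2 h2) (by linarith)
  rw [show θ 1 - θ 0 + (θ 2 - θ 1) = θ 2 - θ 0 by ring] at hpos
  -- This is `hpos` multiplied by `r 0 * r 1 * r 2`. It leaves finitely many cases to test, with
  -- each `r i` equal to `1` or `√2`; repeated slopes make the expression vanish.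
  have key : 0 < (k 1 - k 0) * r 2 + (k 2 - k 1) * r 0 - (k 2 - k 0) * r 1 := by
    rw [hcross 0 1, hcross 1 2, hcross 0 2]
    have := mul_pos hpos (mul_pos (mul_pos (hr 0) (hr 1)) (hr 2))
    linarith
  have e : k = ![k 0, k 1, k 2] := by
    ext i
    fin_cases i <;> rfl
  have hq : 1 < √(2 : ℝ) := Real.lt_sqrt_of_sq_lt (by norm_num)
  rw [e]
  rw [hsq 0, hsq 1, hsq 2] at key
  rcases hk 0 with h0 | h0 | h0 <;> rcases hk 1 with h1 | h1 | h1 <;>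
    rcases hk 2 with h2 | h2 | h2 <;> rw [h0, h1, h2] at key ⊢ <;> norm_num at key <;>
      first | linarith | simp

/-- The direction is constant along a leg, so the limit in `IsCounterclockwise` is the direction of
the edge itself. -/
lemma starLeg_direction {φ : StarGraph 3 → ℂ} (hφ : Function.Injective φ)
    (h0 : φ (starCenter 3) = Complex.I) (hle : ∀ x, (φ x).im ≤ 1) {i : Fin 3} {k : ℝ}
    (hleg : ∀ t, φ (starLeg i t) =
      Complex.I + (1 - (φ (starLeg i t)).im : ℝ) * (k - Complex.I)) {t : unitInterval} (ht : 0 < t) :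
    (φ (starLeg i t) - φ (starCenter 3)) / (‖φ (starLeg i t) - φ (starCenter 3)‖ : ℂ) =
      (k - Complex.I) / (‖(k - Complex.I : ℂ)‖ : ℂ) := by
  have hd : 0 < 1 - (φ (starLeg i t)).im := by
    refine lt_of_le_of_ne (sub_nonneg.2 (hle _)) fun h => ?_
    have he := hleg t
    rw [← h, Complex.ofReal_zero, zero_mul, add_zero, ← h0] at he
    have := congrFun (congrArg Subtype.val (hφ he)) i
    simp only [starLeg, starCenter, Pi.single_eq_same, Pi.zero_apply] at this
    exact ht.ne' (Subtype.ext this)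
  have he : φ (starLeg i t) - φ (starCenter 3) =
      (1 - (φ (starLeg i t)).im : ℝ) * (k - Complex.I) := by
    rw [h0, sub_eq_iff_eq_add']
    exact hleg t
  rw [he, norm_mul, Complex.norm_real, Real.norm_of_nonneg hd.le, Complex.ofReal_mul]
  exact mul_div_mul_left _ _ (Complex.ofReal_ne_zero.2 hd.ne')

lemma edgeSlopes_vec (i : Fin 3) : (![-1, 0, 1] : Fin 3 → ℝ) i ∈ edgeSlopes := by
  fin_cases i <;> simp [edgeSlopes]

lemma injective_slopes : Function.Injective (![-1, 0, 1] : Fin 3 → ℝ) := by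
  intro i j h
  fin_cases i <;> fin_cases j <;> first | rfl | norm_num at h

/-- The standard star at the top vertex of the theta graph. -/
abbrev topStar : StarGraph 3 → ℂ := linearStar ![-1, 0, 1]

lemma starSeg_linearStar_succ {k : Fin 3 → ℝ} (hk : Function.Injective k)
    (hks : ∀ i, k i ∈ edgeSlopes) :
    starSeg (linearStar fun i => k (i + 1)) = starSeg (linearStar k) := by
  rw [← linearStar_comp_starRot]
  exact starSeg_comp_starRot (continuous_linearStar k) (linearStar_injective hk)
    (linearStar_mem hks)

theorem starSeg_eq_topStar {φ : StarGraph 3 → ℂ} (hc : Continuous φ) (hφ : Function.Injective φ)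
    (hm : ∀ x, φ x ∈ thetaSet) (h0 : φ (starCenter 3) = Complex.I) (hccw : IsCounterclockwise φ) :
    starSeg φ = starSeg topStar := by
  obtain ⟨ε, hε, hpos⟩ := exists_starScale_im_pos hc h0
  rw [← starSeg_comp_starScale hc hφ hm hε]
  obtain ⟨ψ, hψ⟩ : ∃ ψ : StarGraph 3 → ℂ, ψ = fun x => φ (starScale ε x) := ⟨_, rfl⟩
  have hψc : Continuous ψ := hψ ▸ hc.comp
    (continuous_starScale.comp (continuous_const.prodMk continuous_id))
  have hψi : Function.Injective ψ := hψ ▸ hφ.comp (starScale_injective hε)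
  have hψm : ∀ x, ψ x ∈ thetaSet := hψ ▸ fun x => hm _
  have hψ0 : ψ (starCenter 3) = Complex.I := by rw [hψ]; simp only [starScale_center, h0]
  have hψccw : IsCounterclockwise ψ := hψ ▸ hccw.comp_starScale hε
  have hψpos : ∀ x, 0 < (ψ x).im := hψ ▸ hpos
  have hψle : ∀ x, (ψ x).im ≤ 1 := fun x => (le_abs_self _).trans (hψm x).1
  rw [← hψ]
  choose k hks hleg using exists_slope hψc hψi hψm hψ0 hψpos
  obtain ⟨θ, h1, h2, h3, h4⟩ := hψccw
  have hdir : ∀ i, (k i - Complex.I : ℂ) =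
      ‖(k i - Complex.I : ℂ)‖ * Complex.exp (θ i * Complex.I) := fun i => by
    have hne : (‖(k i - Complex.I : ℂ)‖ : ℂ) ≠ 0 := by
      refine Complex.ofReal_ne_zero.2 (norm_ne_zero_iff.2 fun h => ?_)
      simpa using congrArg Complex.im h
    have hlim := (h4 i).congr' (f₂ := fun _ => (k i - Complex.I) / (‖(k i - Complex.I : ℂ)‖ : ℂ)) (by
      filter_upwards [self_mem_nhdsWithin] with t ht
      exact starLeg_direction hψi hψ0 hψle (hleg i) ht)
    have : (𝓝[>] (0 : unitInterval)).NeBot := nhdsGT_neBot_of_exists_gt ⟨1, one_pos⟩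
    rw [← tendsto_nhds_unique tendsto_const_nhds hlim, mul_div_cancel₀ _ hne]
  have hcyc := slopes_cyclic hks h1 h2 h3 (fun i => norm_pos_iff.2 fun h => by
    simpa using congrArg Complex.im h) hdir
  have hk : Function.Injective k := by
    rcases hcyc with rfl | rfl | rfl <;> intro i j h <;> fin_cases i <;> fin_cases j <;>
      first | rfl | norm_num at h
  rw [starSeg_eq_linearStar hψc hψi hψ0 hψpos hk hks hψle hleg]
  -- `e1` and `e2` rotate the legs once and twice, which covers all three cyclic orders.
  have e1 := starSeg_linearStar_succ injective_slopes edgeSlopes_vec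
  have e2 := starSeg_linearStar_succ (injective_slopes.comp (add_left_injective (1 : Fin 3)))
    fun i => edgeSlopes_vec _
  rcases hcyc with rfl | rfl | rfl
  · rfl
  · rw [← e1]
    congr 2
    ext i
    fin_cases i <;> rfl
  · rw [← e1]
    refine Eq.trans ?_ e2
    congr 2
    ext i
    fin_cases i <;> rfl

/-! ### The star loop as a sum of six moves -/

lemma starRot_starLeg (i : Fin 3) (t : unitInterval) : starRot (starLeg i t) = starLeg (i + 1) t := by
  refine Subtype.ext (funext fun j => ?_)
  by_cases h : j = i + 1
  · subst h
    simp [starRot, starLeg]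
  · have : j - 1 ≠ i := fun h' => h (by rw [← h']; simp)
    simp [starRot, starLeg, h, this]

lemma orbitCoord_of_abs_le {x : ℝ} {k : Fin 3} (h : |x - ((k : ℕ) : ℝ) / 3| ≤ 1 / 2) :
    orbitCoord (x : S1) k = max 0 (min 1 (2 - 12 * |x - ((k : ℕ) : ℝ) / 3|)) := by
  unfold orbitCoord
  rw [← AddCircle.coe_sub, (AddCircle.norm_coe_eq_abs_iff 1 one_ne_zero).2 (by simpa using h)]

/-- Only the first third of the itinerary is computed; the rest follows by `orbit_add_third`. -/
lemma orbit_eq_of_mem_Icc {x : ℝ} (h0 : 0 ≤ x) (h1 : x ≤ 1 / 3) (j : Fin 3) :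
    (orbit (x : S1)).1 j = ![max 0 (min 1 (2 - 12 * x)), max 0 (min 1 (12 * x - 2)), 0] j := by
  change orbitCoord _ j = _
  fin_cases j
  · change orbitCoord _ 0 = max 0 (min 1 (2 - 12 * x))
    have e : |x - (((0 : Fin 3) : ℕ) : ℝ) / 3| = x := by simp [abs_of_nonneg h0]
    rw [orbitCoord_of_abs_le (by rw [e]; linarith), e]
  · change orbitCoord _ 1 = max 0 (min 1 (12 * x - 2))
    have e : |x - (((1 : Fin 3) : ℕ) : ℝ) / 3| = 1 / 3 - x := by
      rw [abs_of_nonpos (by norm_num; linarith)]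
      norm_num
    rw [orbitCoord_of_abs_le (by rw [e]; linarith), e]
    ring_nf
  · refine orbitCoord_eq_zero ?_
    rw [← AddCircle.coe_sub, UnitAddCircle.norm_eq, le_abs']
    have key : ∀ n : ℤ, x - ((2 : ℕ) : ℝ) / 3 - n ≤ -(1 / 6) ∨
        1 / 6 ≤ x - ((2 : ℕ) : ℝ) / 3 - n := fun n => by
      push_cast
      rcases le_or_gt 0 n with hn | hn
      · have : (0 : ℝ) ≤ n := by exact_mod_cast hn
        left
        linarith
      · have : (n : ℝ) ≤ -1 := by exact_mod_cast Int.le_sub_one_of_lt hn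
        right
        linarith
    exact key _

lemma orbit_eq_starLeg_zero {x : ℝ} (h0 : 0 ≤ x) (h1 : x ≤ 1 / 6) {t : unitInterval}
    (ht : (t : ℝ) = min 1 (2 - 12 * x)) : orbit (x : S1) = starLeg 0 t := by
  refine Subtype.ext (funext fun j => ?_)
  rw [orbit_eq_of_mem_Icc h0 (by linarith)]
  have h2 : (12 * x - 2) ≤ 0 := by linarith
  have h3 : 0 ≤ 2 - 12 * x := by linarith
  fin_cases j <;> simp [starLeg, ht, h2, h3]

lemma orbit_eq_starLeg_one {x : ℝ} (h0 : 1 / 6 ≤ x) (h1 : x ≤ 1 / 3) {t : unitInterval}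
    (ht : (t : ℝ) = min 1 (12 * x - 2)) : orbit (x : S1) = starLeg 1 t := by
  refine Subtype.ext (funext fun j => ?_)
  rw [orbit_eq_of_mem_Icc (by linarith) h1]
  have h2 : (2 - 12 * x) ≤ 0 := by linarith
  have h3 : 0 ≤ 12 * x - 2 := by linarith
  fin_cases j <;> simp [starLeg, ht, h2, h3]

lemma orbit_third_add (x : ℝ) {i : Fin 3} {t : unitInterval} (h : orbit (x : S1) = starLeg i t) :
    orbit ((x + 1 / 3 : ℝ) : S1) = starLeg (i + 1) t := by
  rw [AddCircle.coe_add, orbit_add_third, h, starRot_starLeg]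

/-- The position of the particle at time `(n + u) / 12`. -/
lemma orbit_twelfths (u : unitInterval) :
    orbit ((u / 12 : ℝ) : S1) = starLeg 0 1 ∧
    orbit (((1 + u) / 12 : ℝ) : S1) = starLeg 0 (unitInterval.symm u) ∧
    orbit (((2 + u) / 12 : ℝ) : S1) = starLeg 1 u ∧
    orbit (((3 + u) / 12 : ℝ) : S1) = starLeg 1 1 := by
  have h0 := u.2.1
  have h1 := u.2.2
  refine ⟨orbit_eq_starLeg_zero ?_ ?_ ?_, orbit_eq_starLeg_zero ?_ ?_ ?_,
    orbit_eq_starLeg_one ?_ ?_ ?_, orbit_eq_starLeg_one ?_ ?_ ?_⟩ <;> try linarith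
  · rw [min_eq_left (by linarith), Set.Icc.coe_one]
  · rw [min_eq_right (by linarith), unitInterval.coe_symm_eq]
    ring
  · rw [min_eq_right (by linarith)]
    ring
  · rw [min_eq_left (by linarith), Set.Icc.coe_one]

lemma orbit_twelfths' (u : unitInterval) :
    orbit (((4 + u) / 12 : ℝ) : S1) = starLeg 1 1 ∧
    orbit (((5 + u) / 12 : ℝ) : S1) = starLeg 1 (unitInterval.symm u) ∧
    orbit (((6 + u) / 12 : ℝ) : S1) = starLeg 2 u ∧
    orbit (((7 + u) / 12 : ℝ) : S1) = starLeg 2 1 := by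
  obtain ⟨h0, h1, h2, h3⟩ := orbit_twelfths u
  have a0 := orbit_third_add _ h0
  have a1 := orbit_third_add _ h1
  have a2 := orbit_third_add _ h2
  have a3 := orbit_third_add _ h3
  rw [show (u / 12 + 1 / 3 : ℝ) = (4 + u) / 12 by ring] at a0
  rw [show ((1 + u) / 12 + 1 / 3 : ℝ) = (5 + u) / 12 by ring] at a1
  rw [show ((2 + u) / 12 + 1 / 3 : ℝ) = (6 + u) / 12 by ring] at a2
  rw [show ((3 + u) / 12 + 1 / 3 : ℝ) = (7 + u) / 12 by ring] at a3
  exact ⟨a0, a1, a2, a3⟩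

lemma orbit_twelfths'' (u : unitInterval) :
    orbit (((8 + u) / 12 : ℝ) : S1) = starLeg 2 1 ∧
    orbit (((9 + u) / 12 : ℝ) : S1) = starLeg 2 (unitInterval.symm u) ∧
    orbit (((10 + u) / 12 : ℝ) : S1) = starLeg 0 u ∧
    orbit (((11 + u) / 12 : ℝ) : S1) = starLeg 0 1 := by
  obtain ⟨h0, h1, h2, h3⟩ := orbit_twelfths' u
  have a0 := orbit_third_add _ h0
  have a1 := orbit_third_add _ h1
  have a2 := orbit_third_add _ h2
  have a3 := orbit_third_add _ h3
  rw [show ((4 + u) / 12 + 1 / 3 : ℝ) = (8 + u) / 12 by ring] at a0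
  rw [show ((5 + u) / 12 + 1 / 3 : ℝ) = (9 + u) / 12 by ring] at a1
  rw [show ((6 + u) / 12 + 1 / 3 : ℝ) = (10 + u) / 12 by ring] at a2
  rw [show ((7 + u) / 12 + 1 / 3 : ℝ) = (11 + u) / 12 by ring] at a3
  exact ⟨a0, a1, a2, a3⟩

/-- The second particle is six twelfths of the itinerary ahead of the first. In each sixth of the
loop one particle rests at a tip while the other covers one leg. -/
lemma orbitPair_sixths {φ : StarGraph 3 → ℂ} (u : unitInterval) :
    orbitPair φ ((0 + u) / 6) = (φ (starLeg 0 1), φ (starLeg 2 u)) ∧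
    orbitPair φ ((1 + u) / 6) = (φ (starLeg 0 (unitInterval.symm u)), φ (starLeg 2 1)) ∧
    orbitPair φ ((2 + u) / 6) = (φ (starLeg 1 u), φ (starLeg 2 1)) ∧
    orbitPair φ ((3 + u) / 6) = (φ (starLeg 1 1), φ (starLeg 2 (unitInterval.symm u))) ∧
    orbitPair φ ((4 + u) / 6) = (φ (starLeg 1 1), φ (starLeg 0 u)) ∧
    orbitPair φ ((5 + u) / 6) = (φ (starLeg 1 (unitInterval.symm u)), φ (starLeg 0 1)) := by
  obtain ⟨h0, h1, h2, h3⟩ := orbit_twelfths u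
  obtain ⟨h4, h5, h6, h7⟩ := orbit_twelfths' u
  obtain ⟨h8, h9, h10, h11⟩ := orbit_twelfths'' u
  have aux : ∀ (a : ℝ) {x y}, orbit (((a + u) / 12 : ℝ) : S1) = x →
      orbit ((((a + 6) + u) / 12 : ℝ) : S1) = y → orbitPair φ ((a + u) / 6) = (φ x, φ y) := by
    intro a x y hx hy
    rw [orbitPair, show (a + u) / 6 / 2 = (a + u) / 12 by ring, hx,
      show (a + u) / 12 + 1 / 2 = ((a + 6) + u) / 12 by ring, hy]
  refine ⟨aux 0 (by rwa [zero_add]) (by rwa [zero_add]), aux 1 h1 ?_, aux 2 h2 ?_, aux 3 h3 ?_,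
    aux 4 h4 ?_, aux 5 h5 ?_⟩ <;> norm_num <;> assumption

lemma starSeg_eq_sum_moves {φ : StarGraph 3 → ℂ} (hc : Continuous φ) (hφ : Function.Injective φ)
    (hm : ∀ x, φ x ∈ thetaSet) {v : ℂ} {m : Fin 3 → ℂ}
    (hleg : ∀ i t, φ (starLeg i t) = (1 - (t : ℝ)) * v + (t : ℝ) * m i) :
    starSeg φ = segClass thetaConf (m 0, v) (m 0, m 2) + segClass thetaConf (m 0, m 2) (v, m 2) +
      segClass thetaConf (v, m 2) (m 1, m 2) + segClass thetaConf (m 1, m 2) (m 1, v) +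
      segClass thetaConf (m 1, v) (m 1, m 0) + segClass thetaConf (m 1, m 0) (v, m 0) := by
  have hcont : Continuous fun t => thetaConf (orbitPair φ t) := by
    refine continuousOn_thetaConf.comp_continuous (.prodMk ?_ ?_) (orbitPair_mem hφ hm)
    · exact hc.comp (continuous_orbit_coe.comp (by fun_prop))
    · exact hc.comp (continuous_orbit_coe.comp (by fun_prop))
  have add := fun P Q R => segClass_add (P := P) (Q := Q) (R := R) hcont.continuousOn convex_univ
    trivial trivial trivial
  have piece : ∀ (a : ℝ) (P Q : ℂ × ℂ), (∀ u : unitInterval, orbitPair φ ((a + u) / 6) =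
      ((1 - (u : ℝ) : ℂ) * P.1 + (u : ℝ) * Q.1, (1 - (u : ℝ) : ℂ) * P.2 + (u : ℝ) * Q.2)) →
      segClass (fun t => thetaConf (orbitPair φ t)) (a / 6) ((a + 1) / 6) =
        segClass thetaConf P Q := by
    intro a P Q h
    refine segClass_congr fun s t hs ht hst => ?_
    have hu := h ⟨t, ht, by linarith⟩
    obtain rfl : s = 1 - t := by linarith
    rw [show (1 - t) • (a / 6) + t • ((a + 1) / 6) = (a + t) / 6 by simp; ring, hu]
    congr 1
    ext <;> simp
  have h := orbitPair_sixths (φ := φ)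
  rw [← piece 0, ← piece 1, ← piece 2, ← piece 3, ← piece 4, ← piece 5]
  · norm_num [add, starSeg]
  all_goals
    intro u
    simp only [h u, hleg, unitInterval.coe_symm_eq, Set.Icc.coe_one]
    ext <;> simp <;> ring

/-! ### The relation between the two star classes -/

/-- Part of an edge of the theta graph: the points at heights in `[l, r]` (upper half, `σ = 1`) or
`[-r, -l]` (lower half, `σ = -1`) of the edge with slope `k`. -/
def edgePart (σ k l r : ℝ) : Set ℂ := {z | z.re = k * (1 - σ * z.im) ∧ l ≤ σ * z.im ∧ σ * z.im ≤ r}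

lemma convex_edgePart (σ k l r : ℝ) : Convex ℝ (edgePart σ k l r) := by
  rintro x ⟨hx1, hx2, hx3⟩ y ⟨hy1, hy2, hy3⟩ a b ha hb hab
  obtain rfl : a = 1 - b := by linarith
  refine ⟨?_, ?_, ?_⟩ <;> simp
  · linear_combination (1 - b) * hx1 + b * hy1
  · have := mul_le_mul_of_nonneg_left hx2 ha
    have := mul_le_mul_of_nonneg_left hy2 hb
    linarith
  · have := mul_le_mul_of_nonneg_left hx3 ha
    have := mul_le_mul_of_nonneg_left hy3 hb
    linarith

lemma edgePart_subset {σ k l r : ℝ} (hσ : σ = 1 ∨ σ = -1) (hk : k ∈ edgeSlopes) (hl : 0 ≤ l)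
    (hr : r ≤ 1) : edgePart σ k l r ⊆ thetaSet := by
  rintro z ⟨h1, h2, h3⟩
  have : |z.im| = σ * z.im := by
    rcases hσ with rfl | rfl
    · rw [one_mul]
      exact abs_of_nonneg (by linarith)
    · rw [neg_one_mul]
      exact abs_of_nonpos (by linarith)
  exact ⟨by linarith, k, hk, by rw [this, h1]⟩

/-- An upper and a lower part can meet only at height `0`, where their points are `k` and `k'`.
Distinct slopes, or one part staying off the axis, exclude this. -/
lemma edgePart_prod_subset {k l k' l' : ℝ} (hk : k ∈ edgeSlopes) (hk' : k' ∈ edgeSlopes)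
    {r r' : ℝ} (hl : 0 ≤ l) (hr : r ≤ 1) (hl' : 0 ≤ l') (hr' : r' ≤ 1)
    (hd : k ≠ k' ∨ 0 < l + l') :
    edgePart 1 k l r ×ˢ edgePart (-1) k' l' r' ⊆ thetaPairs := by
  rintro ⟨z, w⟩ ⟨hz, hw⟩
  refine ⟨edgePart_subset (.inl rfl) hk hl hr hz, edgePart_subset (.inr rfl) hk' hl' hr' hw, ?_⟩
  intro h
  obtain rfl : z = w := h
  obtain ⟨h1, h2, -⟩ := hz
  obtain ⟨h3, h4, -⟩ := hw
  simp only at h1 h2 h3 h4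
  have h0 : z.im = 0 := by linarith
  simp only [h0] at h1 h2 h3 h4
  rcases hd with hd | hd
  · exact hd (by linarith)
  · linarith

/-- The class of the move of one particle along the segment from `z` to `z'` while the other one
rests at `w`. -/
def move (z z' w : ℂ) : ChainClass (UnordConf 2 Theta) := segClass thetaConf (z, w) (z', w)

lemma segClass_snd_eq_move (w z z' : ℂ) : segClass thetaConf (w, z) (w, z') = move z z' w :=
  segClass_congr fun _ _ _ _ _ => (thetaConf_swap _).symm

lemma segClass_fst_eq_move (w z z' : ℂ) : segClass thetaConf (z, w) (z', w) = move z z' w := rfl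

lemma move_add {S : Set ℂ} (hS : Convex ℝ S) {w : ℂ} (h : S ×ˢ {w} ⊆ thetaPairs) {x y z : ℂ}
    (hx : x ∈ S) (hy : y ∈ S) (hz : z ∈ S) : move x y w + move y z w = move x z w :=
  segClass_add (continuousOn_thetaConf.mono h) (hS.prod (convex_singleton w))
    ⟨hx, rfl⟩ ⟨hy, rfl⟩ ⟨hz, rfl⟩

lemma move_symm {S : Set ℂ} (hS : Convex ℝ S) {w : ℂ} (h : S ×ˢ {w} ⊆ thetaPairs) {x y : ℂ}
    (hx : x ∈ S) (hy : y ∈ S) : move y x w = -move x y w := by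
  rw [eq_neg_iff_add_eq_zero, move_add hS h hy hx hy]
  exact segClass_self _ _

/-- Moves of the two particles along disjoint segments commute. -/
lemma move_comm {S T : Set ℂ} (hS : Convex ℝ S) (hT : Convex ℝ T) (h : S ×ˢ T ⊆ thetaPairs)
    {z z' w w' : ℂ} (hz : z ∈ S) (hz' : z' ∈ S) (hw : w ∈ T) (hw' : w' ∈ T) :
    move z z' w + move w w' z' = move w w' z + move z z' w' := by
  rw [← segClass_snd_eq_move z', ← segClass_snd_eq_move z]
  have hc := continuousOn_thetaConf.mono h
  have e1 : (z, w) ∈ S ×ˢ T := ⟨hz, hw⟩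
  have e2 : (z', w') ∈ S ×ˢ T := ⟨hz', hw'⟩
  have e3 : (z', w) ∈ S ×ˢ T := ⟨hz', hw⟩
  have e4 : (z, w') ∈ S ×ˢ T := ⟨hz, hw'⟩
  -- Both sides equal the diagonal of the rectangle of configurations.
  exact (segClass_add hc (hS.prod hT) e1 e3 e2).trans (segClass_add hc (hS.prod hT) e1 e4 e2).symm

open Complex in
/-- The defect between the moves through the top vertex and those through the bottom vertex does not
depend on the outer edge `s = ±1`. -/
lemma moves_top_eq_moves_bottom {s : ℝ} (hs : s = 1 ∨ s = -1) :
    move s I (-s) - move 0 I (-s) - move s I 0 =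
      move (-s) (-I) s - move 0 (-I) s - move (-s) (-I) 0 +
        (move (I / 2) 0 (-I) - move (I / 2) I (-I) + move (-I / 2) (-I) I - move (-I / 2) 0 I) := by
  have hs1 : s ∈ edgeSlopes := by rcases hs with rfl | rfl <;> simp [edgeSlopes]
  have hs2 : -s ∈ edgeSlopes := by rcases hs with rfl | rfl <;> simp [edgeSlopes]
  have hs0 : (0 : ℝ) ∈ edgeSlopes := by simp [edgeSlopes]
  have hne0 : s ≠ 0 := by rcases hs with rfl | rfl <;> norm_num
  have hne : s ≠ -s := by rcases hs with rfl | rfl <;> norm_num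
  have c := convex_edgePart
  have d1 := edgePart_prod_subset (l := 0) (l' := 0) (r := 1) (r' := 1) hs1 hs2 le_rfl le_rfl le_rfl
    le_rfl (.inl hne)
  have d2 := edgePart_prod_subset (l := 0) (l' := 0) (r := 1) (r' := 1) hs1 hs0 le_rfl le_rfl le_rfl
    le_rfl (.inl hne0)
  have d3 := edgePart_prod_subset (l := 0) (l' := 0) (r := 1) (r' := 1) hs0 hs2 le_rfl le_rfl le_rfl
    le_rfl (.inl (neg_ne_zero.2 hne0).symm)
  have a0 : (0 : ℂ) ∈ edgePart 1 0 0 1 := by simp [edgePart]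
  have a1 : I / 2 ∈ edgePart 1 0 0 1 := by norm_num [edgePart]
  have a2 : I ∈ edgePart 1 0 0 1 := by norm_num [edgePart]
  have b0 : (0 : ℂ) ∈ edgePart (-1) 0 0 1 := by simp [edgePart]
  have b1 : -I / 2 ∈ edgePart (-1) 0 0 1 := by norm_num [edgePart]
  have b2 : -I ∈ edgePart (-1) 0 0 1 := by norm_num [edgePart]
  have s0 : (s : ℂ) ∈ edgePart 1 s 0 1 := by simp [edgePart]
  have s1 : I ∈ edgePart 1 s 0 1 := by simp [edgePart]
  have t0 : (-s : ℂ) ∈ edgePart (-1) (-s) 0 1 := by simp [edgePart]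
  have t1 : -I ∈ edgePart (-1) (-s) 0 1 := by simp [edgePart]
  -- `r1` treats the pair of outer edges; `r2`, `r3`, `r7` the edges `s` and `0`; `r4`, `r5`, `r6`
  -- the edges `0` and `-s`. The moves of an outer particle with the other at the opposite vertex
  -- cancel between these groups. What remains besides the wanted terms are moves on the middle edge
  -- with the other particle at a vertex, and these do not involve `s`.
  have r1 := move_comm (c _ _ _ _) (c _ _ _ _) d1 s0 s1 t0 t1
  have r2 := move_comm (c _ _ _ _) (c _ _ _ _) d2 s0 s1 b1 b2
  have r3 := move_comm (c _ _ _ _) (c _ _ _ _) d2 s0 s1 b1 b0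
  have r4 := move_comm (c _ _ _ _) (c _ _ _ _) d3 a1 a2 t0 t1
  have r5 := move_comm (c _ _ _ _) (c _ _ _ _) d3 a1 a0 t0 t1
  have r6 := move_add (c _ _ _ _) ((Set.prod_mono_right (Set.singleton_subset_iff.2 t0)).trans d3)
    a1 a0 a2
  -- Here the moving particle is in the lower half, so the inclusion `d2` is used with its factors
  -- exchanged.
  have d2' : edgePart (-1) 0 0 1 ×ˢ {(s : ℂ)} ⊆ thetaPairs := fun p hp =>
    swap_mem_thetaPairs.1 (d2 ⟨show p.2 ∈ _ by rwa [show p.2 = s from hp.2], hp.1⟩)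
  have r7 := move_add (c _ _ _ _) d2' b1 b0 b2
  linear_combination (norm := module) r1 - r2 + r3 - r4 + r5 - r6 + r7

open Complex in
-- Used to direct every move of the six-term sum towards the vertex. The resting point `k'` lies on
-- the axis, so it counts as part of a lower half.
lemma move_top_symm {k k' : ℝ} (hk : k ∈ edgeSlopes) (hk' : k' ∈ edgeSlopes) (h : k ≠ k') :
    move I k k' = -move k I k' := by
  have d := edgePart_prod_subset (l := 0) (l' := 0) (r := 1) (r' := 1) hk hk' le_rfl le_rfl le_rfl
    le_rfl (.inl h)
  exact move_symm (convex_edgePart 1 k 0 1)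
    ((Set.prod_mono_right (Set.singleton_subset_iff.2 (by simp [edgePart]))).trans d)
    (by simp [edgePart]) (by simp [edgePart])

open Complex in
lemma move_bottom_symm {k k' : ℝ} (hk : k ∈ edgeSlopes) (hk' : k' ∈ edgeSlopes) (h : k ≠ k') :
    move (-I) k k' = -move k (-I) k' := by
  have d := edgePart_prod_subset (l := 0) (l' := 0) (r := 1) (r' := 1) hk' hk le_rfl le_rfl le_rfl
    le_rfl (.inl h.symm)
  have d' : edgePart (-1) k 0 1 ×ˢ {(k' : ℂ)} ⊆ thetaPairs := fun p hp =>
    swap_mem_thetaPairs.1 (d ⟨show p.2 ∈ _ by simp [show p.2 = k' from hp.2, edgePart], hp.1⟩)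
  exact move_symm (convex_edgePart (-1) k 0 1) d' (by simp [edgePart]) (by simp [edgePart])

lemma topStar_injective : Function.Injective topStar := linearStar_injective injective_slopes

lemma topStar_mem (x : StarGraph 3) : topStar x ∈ thetaSet := linearStar_mem edgeSlopes_vec x

lemma neg_mem_thetaSet {z : ℂ} (hz : z ∈ thetaSet) : -z ∈ thetaSet := by
  obtain ⟨h1, k, hk, h2⟩ := hz
  refine ⟨by simpa using h1, -k, ?_, by simp [h2]⟩
  rcases hk with rfl | rfl | rfl <;> simp

lemma starSeg_neg_topStar : starSeg (fun x => -topStar x) = starSeg topStar := by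
  have hm : (-1 : ℝ) ∈ edgeSlopes := by simp [edgeSlopes]
  have h0 : (0 : ℝ) ∈ edgeSlopes := by simp [edgeSlopes]
  have hp : (1 : ℝ) ∈ edgeSlopes := by simp [edgeSlopes]
  have n1 : (-1 : ℝ) ≠ 0 := by norm_num
  have n2 : (-1 : ℝ) ≠ 1 := by norm_num
  have n3 : (1 : ℝ) ≠ 0 := by norm_num
  have e1 := starSeg_eq_sum_moves (continuous_linearStar _) topStar_injective topStar_mem
    (v := Complex.I) (m := ![((-1 : ℝ) : ℂ), ((0 : ℝ) : ℂ), ((1 : ℝ) : ℂ)]) fun i t => by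
      rw [linearStar_starLeg]
      fin_cases i <;> simp <;> ring
  have e2 := starSeg_eq_sum_moves (φ := fun x => -topStar x) (continuous_linearStar _).neg
    (neg_injective.comp topStar_injective) (fun x => neg_mem_thetaSet (topStar_mem x))
    -- The half turn reverses the order of the tips.
    (v := -Complex.I) (m := ![((1 : ℝ) : ℂ), ((0 : ℝ) : ℂ), ((-1 : ℝ) : ℂ)]) fun i t => by
      rw [topStar, linearStar_starLeg]
      fin_cases i <;> simp <;> ring
  simp only [Matrix.cons_val_zero, Matrix.cons_val_one, Matrix.cons_val, segClass_snd_eq_move]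
    at e1 e2
  simp only [segClass_fst_eq_move, move_top_symm, move_bottom_symm, hm, h0, hp, n1, n2, n3,
    n1.symm, n2.symm, n3.symm, ne_eq, not_false_eq_true] at e1 e2
  have k1 := moves_top_eq_moves_bottom (s := 1) (.inl rfl)
  have k2 := moves_top_eq_moves_bottom (s := -1) (.inr rfl)
  rw [e1, e2]
  push_cast at k1 k2 ⊢
  rw [neg_neg] at k2
  linear_combination (norm := module) k1 - k2

/-! ### Orientations -/

/-- A half turn adds `π` to every angle. -/
lemma IsCounterclockwise.neg {φ : StarGraph 3 → ℂ} (h : IsCounterclockwise φ) :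
    IsCounterclockwise fun x => -φ x := by
  obtain ⟨θ, h1, h2, h3, h4⟩ := h
  refine ⟨fun i => θ i + Real.pi, by linarith, by linarith, by linarith, fun i => ?_⟩
  have := (h4 i).neg
  rw [Complex.ofReal_add, add_mul, Complex.exp_add, Complex.exp_pi_mul_I, mul_neg_one]
  refine this.congr fun t => ?_
  rw [← neg_sub_neg, neg_sub_neg, ← neg_div, neg_sub, neg_sub_neg, norm_sub_rev]

lemma isCounterclockwise_topStar : IsCounterclockwise topStar := by
  have hc : topStar (starCenter 3) = Complex.I := by simp [linearStar, starCenter]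
  have hleg : ∀ i t, topStar (starLeg i t) = Complex.I +
      (1 - (topStar (starLeg i t)).im : ℝ) * ((![-1, 0, 1] : Fin 3 → ℝ) i - Complex.I) := by
    intro i t
    rw [topStar, linearStar_starLeg]
    simp
  have hpi := Real.pi_pos
  -- These are the arguments of `-1 - I`, `-I` and `1 - I`, the edge directions at the top vertex.
  refine ⟨![-(3 * Real.pi / 4), -(Real.pi / 2), -(Real.pi / 4)], ?_, ?_, ?_, fun i => ?_⟩
  · simp
    linarith
  · simp
    linarith
  · simp
    linarith
  refine tendsto_const_nhds.congr' ?_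
  filter_upwards [self_mem_nhdsWithin] with t ht
  refine Eq.trans ?_ (starLeg_direction topStar_injective hc
    (fun x => (le_abs_self _).trans (topStar_mem x).1) (hleg i) ht).symm
  have polar : ∀ {z : ℂ} {r θ : ℝ}, 0 < r → z = r * Complex.exp (θ * Complex.I) →
      Complex.exp (θ * Complex.I) = z / (‖z‖ : ℂ) := by
    intro z r θ hr hz
    have hn : ‖z‖ = r := by
      rw [hz, norm_mul, Complex.norm_exp_ofReal_mul_I, mul_one, Complex.norm_real,
        Real.norm_of_nonneg hr.le]
    rw [hn, eq_div_iff (Complex.ofReal_ne_zero.2 hr.ne'), hz, mul_comm]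
  have h2 : √2 * (√2 / 2) = 1 := by
    rw [← mul_div_assoc, Real.mul_self_sqrt zero_le_two]
    norm_num
  fin_cases i
  · refine polar (r := √2) (by positivity) (Complex.ext ?_ ?_) <;>
      simp only [Complex.re_ofReal_mul, Complex.im_ofReal_mul, Complex.exp_ofReal_mul_I_re,
        Complex.exp_ofReal_mul_I_im] <;>
      simp [show 3 * Real.pi / 4 = Real.pi - Real.pi / 4 by ring, h2]
  · refine polar (r := 1) one_pos (Complex.ext ?_ ?_) <;>
      simp only [Complex.re_ofReal_mul, Complex.im_ofReal_mul, Complex.exp_ofReal_mul_I_re,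
        Complex.exp_ofReal_mul_I_im] <;> simp
  · refine polar (r := √2) (by positivity) (Complex.ext ?_ ?_) <;>
      simp only [Complex.re_ofReal_mul, Complex.im_ofReal_mul, Complex.exp_ofReal_mul_I_re,
        Complex.exp_ofReal_mul_I_im] <;> simp [h2]

/-! ### Star classes -/

lemma isCompact_starSet (n : ℕ) : IsCompact (starSet n) := by
  refine (isCompact_univ_pi fun _ : Fin n => isCompact_Icc (a := (0 : ℝ)) (b := 1)).of_isClosed_subset
    ?_ fun x hx i _ => hx.1 i
  have e : starSet n = (⋂ i, {x | 0 ≤ x i} ∩ {x | x i ≤ 1}) ∩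
      ⋂ i, ⋂ j, ⋂ _ : i ≠ j, {x | x i = 0} ∪ {x | x j = 0} := by
    ext x
    simp [starSet]
  rw [e]
  refine (isClosed_iInter fun i => ?_).inter
    (isClosed_iInter fun i => isClosed_iInter fun j => isClosed_iInter fun _ => ?_)
  · exact (isClosed_le continuous_const (continuous_apply i)).inter
      (isClosed_le (continuous_apply i) continuous_const)
  · exact (isClosed_eq (continuous_apply i) continuous_const).union
      (isClosed_eq (continuous_apply j) continuous_const)

/-- The star is compact, and a continuous injection from a compact space to a Hausdorff one is a
closed embedding. -/
lemma isEmbedding_of_injective {n : ℕ} {X : Type*} [TopologicalSpace X] [T2Space X]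
    (φ : C(StarGraph n, X)) (hφ : Function.Injective φ) : IsEmbedding φ := by
  have := isCompact_iff_compactSpace.1 (isCompact_starSet n)
  exact (φ.continuous.isClosedEmbedding hφ).isEmbedding

lemma H1map_comp {X Y Z : Type} [TopologicalSpace X] [TopologicalSpace Y] [TopologicalSpace Z]
    (g : C(Y, Z)) (f : C(X, Y)) : H1map (g.comp f) = H1map f ≫ H1map g :=
  Functor.map_comp _ (TopCat.ofHom f) (TopCat.ofHom g)

lemma starClass_comp {X Y : Type} [TopologicalSpace X] [TopologicalSpace Y] (ρ : C(X, Y))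
    (hρ : Function.Injective ρ) (φ : C(StarGraph 3, X)) (hφ : IsEmbedding φ)
    (h : IsEmbedding (ρ.comp φ)) :
    starClass (ρ.comp φ) h = (H1map (unordConfMap 2 ρ hρ)).hom (starClass φ hφ) := by
  have e : (unordConfMap 2 (ρ.comp φ) h.injective).comp starLoop =
      (unordConfMap 2 ρ hρ).comp ((unordConfMap 2 φ hφ.injective).comp starLoop) := by
    ext s
    simp only [ContinuousMap.comp_apply]
    induction starLoop s using Quotient.inductionOn with | h x => rfl
  rw [starClass, e, H1map_comp]
  rfl

/-- The half turn of the theta graph. -/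
def thetaNeg : C(Theta, Theta) :=
  ⟨fun z => ⟨-z, neg_mem_thetaSet z.2⟩, continuous_subtype_val.neg.subtype_mk _⟩

lemma thetaNeg_injective : Function.Injective thetaNeg := fun z w h => by
  have := congrArg (fun z : Theta => -(z : ℂ)) h
  exact Subtype.ext (by simpa [thetaNeg] using this)

lemma thetaNeg_comp_thetaNeg (φ : C(StarGraph 3, Theta)) :
    thetaNeg.comp (thetaNeg.comp φ) = φ := by
  ext x
  simp [thetaNeg]

/-- The standard star at the top vertex, as a map to the theta graph. -/
def topStarMap : C(StarGraph 3, Theta) :=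
  ⟨fun x => ⟨topStar x, topStar_mem x⟩, (continuous_linearStar _).subtype_mk _⟩

lemma topStarMap_injective : Function.Injective topStarMap := fun _ _ h =>
  topStar_injective (congrArg Subtype.val h)

lemma topStarMap_center : topStarMap (starCenter 3) = thetaTop :=
  Subtype.ext (by simp [topStarMap, linearStar, starCenter, thetaTop])

lemma starClass_eq_of_top {φ : C(StarGraph 3, Theta)} (hφ : IsEmbedding φ)
    (h0 : φ (starCenter 3) = thetaTop) (hccw : IsCounterclockwise fun x => (φ x : ℂ)) :
    starClass φ hφ = starClass topStarMap (isEmbedding_of_injective _ topStarMap_injective) := by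
  apply homologyToChainClass_injective
  rw [homologyToChainClass_starClass, homologyToChainClass_starClass]
  exact starSeg_eq_topStar (continuous_subtype_val.comp φ.continuous)
    (Subtype.val_injective.comp hφ.injective) (fun x => (φ x).2) (congrArg Subtype.val h0) hccw

lemma starClass_thetaNeg_topStarMap (h : IsEmbedding (thetaNeg.comp topStarMap)) :
    starClass (thetaNeg.comp topStarMap) h =
      starClass topStarMap (isEmbedding_of_injective _ topStarMap_injective) := by
  apply homologyToChainClass_injective
  rw [homologyToChainClass_starClass, homologyToChainClass_starClass]
  exact starSeg_neg_topStar

/-- The half turn carries `φ` to a counterclockwise star at the top, whose class is the standard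
one. Applying the half turn again recovers `φ`, and `starClass_thetaNeg_topStarMap` says that it
fixes the standard class. -/
lemma starClass_eq_of_bottom {φ : C(StarGraph 3, Theta)} (hφ : IsEmbedding φ)
    (h0 : φ (starCenter 3) = thetaBottom) (hccw : IsCounterclockwise fun x => (φ x : ℂ)) :
    starClass φ hφ = starClass topStarMap (isEmbedding_of_injective _ topStarMap_injective) := by
  have hn := isEmbedding_of_injective (thetaNeg.comp φ) (thetaNeg_injective.comp hφ.injective)
  have e := starClass_eq_of_top hn
    (Subtype.ext (by simp [thetaNeg, h0, thetaBottom, thetaTop])) hccw.neg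
  have hφ' : IsEmbedding (thetaNeg.comp (thetaNeg.comp φ)) := by
    rwa [thetaNeg_comp_thetaNeg]
  have e' : starClass φ hφ = starClass (thetaNeg.comp (thetaNeg.comp φ)) hφ' := by
    simp only [thetaNeg_comp_thetaNeg]
  rw [e', starClass_comp thetaNeg thetaNeg_injective _ hn, e,
    ← starClass_comp thetaNeg thetaNeg_injective _ _
      (isEmbedding_of_injective _ (thetaNeg_injective.comp topStarMap_injective)),
    starClass_thetaNeg_topStarMap]

end
/-- In `H₁(B_2(Θ_3))`, the star class at the top vertex and the star class at the bottom vertex, both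
oriented counterclockwise, are well defined and coincide. -/
theorem proposition4p5 :
    ∃ c : H1 (UnordConf 2 Theta),
      (∀ x, IsCounterclockwiseStarClass thetaTop x ↔ x = c) ∧
      (∀ x, IsCounterclockwiseStarClass thetaBottom x ↔ x = c) := by
  refine ⟨starClass topStarMap (isEmbedding_of_injective _ topStarMap_injective),
    fun x => ⟨?_, ?_⟩, fun x => ⟨?_, ?_⟩⟩
  · rintro ⟨φ, hφ, h0, hccw, rfl⟩
    exact starClass_eq_of_top hφ h0 hccw
  · rintro rfl
    exact ⟨topStarMap, _, topStarMap_center, isCounterclockwise_topStar, rfl⟩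
  · rintro ⟨φ, hφ, h0, hccw, rfl⟩
    exact starClass_eq_of_bottom hφ h0 hccw
  · rintro rfl
    refine ⟨thetaNeg.comp topStarMap,
      isEmbedding_of_injective _ (thetaNeg_injective.comp topStarMap_injective), ?_,
      isCounterclockwise_topStar.neg, (starClass_thetaNeg_topStarMap _).symm⟩
    exact Subtype.ext (by simp [topStarMap_center, thetaNeg, thetaBottom, thetaTop])
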